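/- Let $\mathrm J\in\{\mathrm{II},\mathrm{III},\mathrm{IV},\mathrm V,\mathrm{VI}\}$, $m\in\mathbb Z_{\ge0}$ and $a,b,c,d\in\mathbb C$. Define the Hamiltonians (at $\hbar=1$, with $\partial=\partial/\partial x$) $$\begin{aligned} t(t-1)\widehat H_{\mathrm{VI}}&=x(x-1)(x-t)\partial^2-\big((a+b)(x-1)(x-t)+cx(x-t)+dx(x-1)\big)\partial+(b+c+d+1)a(x-t),\\ t\widehat H_{\mathrm V}&=x(x-1)\partial^2+\big(tx^2-(b+c+t)x+b\big)\partial+a(b+c-a+1+t-tx),\\ \widehat H_{\mathrm{IV}}&=-\big(x\partial^2+(x^2-tx-b)\partial-ax+at\big),\\ t\widehat H_{\mathrm{III}}&=x^2\partial^2-(x^2+bx+t)\partial+ax,\\ \widehat H_{\mathrm{II}}&=\tfrac12\partial^2-\big(x^2+\tfrac t2\big)\partial+ax, \end{aligned}$$ and the (multivalued) master functions $$\begin{aligned} \rho_{\mathrm{VI}}&=u^{-a-b-1}(1-u)^{-c-1}(t-u)^{-d},\qquad \rho_{\mathrm V}=u^{-b-1}(1-u)^{-c-1}e^{ut},\qquad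 \rho_{\mathrm{IV}}=u^{-b-1}e^{-ut+u^2/2},\\ \rho_{\mathrm{III}}&=u^{-b-1}e^{t/u-u},\qquad \rho_{\mathrm{II}}=e^{-(ut+\frac23u^3)}. \end{aligned}$$ Let $U\subset\mathbb C$ be an open set of times, with $0,1\notin U$ if $\mathrm J=\mathrm{VI}$ and $0\notin U$ if $\mathrm J=\mathrm{III},\mathrm V$. Let $\Gamma_1$ be a twisted $1$-cycle for $\rho_{\mathrm J}$ that does not depend on $t\in U$, that is, a finite complex linear combination of $C^1$ paths which avoid the singular points of $\rho_{\mathrm J}$ (the points $0,1,t$ for $\mathrm{VI}$; $0,1$ for $\mathrm V$; $0$ for $\mathrm{III},\mathrm{IV}$; none for $\mathrm{II}$) for all $t\in U$, each with a branch of $\rho_{\mathrm J}$ continuous along the path and in $t$, such that the twisted boundary vanishes. An end of a path may be open, running into $\infty$ or into a singular point other than $t$; open ends do not contribute to the boundary. Assume that the moments $$\tau_{\mathrm J}^{(i)}(t)=\int_{\Gamma_1}u^i\rho_{\mathrm J}(u,t)\,du\qquad(0\le i\le 2m-1)$$ converge absolutely and locally uniformly for $t\in U$ (which is automatic if no path has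 an open end), in the sense that near each $t_0\in U$ the parametrized integrands are dominated by an integrable function not depending on $t$. Let $$P^{\mathrm J}_m(x,t)=\begin{vmatrix}\tau_{\mathrm J}^{(0)}&\tau_{\mathrm J}^{(1)}&\cdots&\tau_{\mathrm J}^{(m)}\\ \tau_{\mathrm J}^{(1)}&\tau_{\mathrm J}^{(2)}&\cdots&\tau_{\mathrm J}^{(m+1)}\\ \vdots&&&\vdots\\ \tau_{\mathrm J}^{(m-1)}&\cdots&\cdots&\tau_{\mathrm J}^{(2m-1)}\\ 1&x&\cdots&x^m\end{vmatrix}.$$ If $a=m$, or if $\mathrm J=\mathrm{VI}$ and $b+c+d=m-1$, then $P^{\mathrm J}_m$ is differentiable in $x\in\mathbb C$ and in $t\in U$ and $$\frac{\partial}{\partial t}P^{\mathrm J}_m(x,t)=\widehat H_{\mathrm J}\,P^{\mathrm J}_m(x,t)\qquad(x\in\mathbb C,\ t\in U).$$ -/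

import Mathlib

open Filter Topology

namespace QuantumPainleve

noncomputable section

/-- The five types of quantum Painlevé equations. -/
inductive PainleveType where
  | II | III | IV | V | VI

/-- The complex parameters. Only type VI uses all of them: type V uses `a, b, c`, types III and IV
use `a, b`, and type II uses `a`. -/
structure Params where
  a : ℂ
  b : ℂ
  c : ℂ
  d : ℂ

/-- The momentum operator `ħ ∂/∂x`. -/
def momentum (ħ : ℂ) (f : ℂ → ℂ) : ℂ → ℂ := fun x => ħ * deriv f x

/-- The quantized Hamiltonian of type `J` at time `t`, a differential operator in `x`. -/
def hamiltonian (J : PainleveType) (ħ : ℂ) (q : Params) (t : ℂ) (f : ℂ → ℂ) (x : ℂ) : ℂ :=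
  match J with
  | .VI =>
      (x * (x - 1) * (x - t) * momentum ħ (momentum ħ f) x
        - ((q.a + q.b) * (x - 1) * (x - t) + q.c * x * (x - t) + q.d * x * (x - 1))
            * momentum ħ f x
        + (q.b + q.c + q.d + ħ) * q.a * (x - t) * f x) / (t * (t - 1))
  | .V =>
      (x * (x - 1) * momentum ħ (momentum ħ f) x
        + (t * x ^ 2 - (q.b + q.c + t) * x + q.b) * momentum ħ f x
        + q.a * (q.b + q.c - q.a + ħ + t - t * x) * f x) / t
  | .IV =>
      -(x * momentum ħ (momentum ħ f) x
        + (x ^ 2 - t * x - q.b) * momentum ħ f x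
        - q.a * x * f x + q.a * t * f x)
  | .III =>
      (x ^ 2 * momentum ħ (momentum ħ f) x
        - (x ^ 2 + q.b * x + t) * momentum ħ f x
        + q.a * x * f x) / t
  | .II =>
      1 / 2 * momentum ħ (momentum ħ f) x
        - (x ^ 2 + t / 2) * momentum ħ f x
        + q.a * x * f x

/-- The times at which the coefficients of the Hamiltonian of type `J` are regular. -/
def IsRegularTime (J : PainleveType) (t : ℂ) : Prop :=
  match J with
  | .VI => t ≠ 0 ∧ t ≠ 1
  | .V | .III => t ≠ 0
  | .IV | .II => True

/-- `Φ (x, t)` solves `ħ ∂Φ/∂t = H_J(x, ħ ∂/∂x, t) Φ` for all `x ∈ ℂ` and all `t` in `U`. -/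
def SolvesSchrodinger (J : PainleveType) (ħ : ℂ) (q : Params) (U : Set ℂ)
    (Φ : ℂ → ℂ → ℂ) : Prop :=
  (∀ t ∈ U, Differentiable ℂ (fun x => Φ x t)) ∧
  ∀ t ∈ U, ∀ x : ℂ, DifferentiableAt ℂ (fun s => Φ x s) t ∧
    ħ * deriv (fun s => Φ x s) t = hamiltonian J ħ q t (fun y => Φ y t) x

/-- The finite singular points of the master function of type `J` that do not move with `t`
(in type VI there is also the singular point `u = t`). -/
def fixedSingularities (J : PainleveType) : Set ℂ :=
  match J with
  | .VI | .V => {0, 1}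
  | .IV | .III => {0}
  | .II => ∅

/-- The value at `(u, t)` of the branch of the master function `ρ_J` given by the values
`l₀, l₁, lₜ` of logarithms of `u`, `1 - u`, `t - u`. -/
def masterFunction (J : PainleveType) (q : Params) (t u l₀ l₁ lₜ : ℂ) : ℂ :=
  match J with
  | .VI => Complex.exp ((-q.a - q.b - 1) * l₀) * Complex.exp ((-q.c - 1) * l₁)
      * Complex.exp (-q.d * lₜ)
  | .V => Complex.exp ((-q.b - 1) * l₀) * Complex.exp ((-q.c - 1) * l₁) * Complex.exp (u * t)
  | .IV => Complex.exp ((-q.b - 1) * l₀) * Complex.exp (-(u * t) + u ^ 2 / 2)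
  | .III => Complex.exp ((-q.b - 1) * l₀) * Complex.exp (t / u - u)
  | .II => Complex.exp (-(u * t + 2 / 3 * u ^ 3))

/-- The parameter interval of a path: `[0, 1]` with the end `0` removed if `openStart` is true and
the end `1` removed if `openEnd` is true. -/
def pathDomain (openStart openEnd : Bool) : Set ℝ :=
  {s | 0 ≤ s ∧ s ≤ 1 ∧ (openStart = true → s ≠ 0) ∧ (openEnd = true → s ≠ 1)}

/-- Along the filter `l` the path runs into `∞` or into a fixed singular point. -/
def RunsIntoSingularity (J : PainleveType) (γ : ℝ → ℂ) (l : Filter ℝ) : Prop :=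
  Tendsto γ l (Bornology.cobounded ℂ) ∨ ∃ p ∈ fixedSingularities J, Tendsto γ l (𝓝 p)

/-- A `C¹` path in the complement of the singular points of the master function of type `J` at
every time `t ∈ U`, together with a choice of a branch of the master function along it. The branch
is given by logarithms of `u`, `1 - u` (where these vanish at a singular point) and `t - u` (type
VI), continuous along the path and in `t`. An end of the path is either a point of the complement
or open, and an open end runs into a fixed singular point or into `∞`. -/
structure TwistedPath (J : PainleveType) (U : Set ℂ) where
  toFun : ℝ → ℂ
  openStart : Bool
  openEnd : Bool
  contDiffOn : ContDiffOn ℝ 1 toFun (pathDomain openStart openEnd)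
  start_singular : openStart = true → RunsIntoSingularity J toFun (𝓝[>] 0)
  end_singular : openEnd = true → RunsIntoSingularity J toFun (𝓝[<] 1)
  log₀ : ℝ → ℂ
  log₁ : ℝ → ℂ
  logₜ : ℝ → ℂ → ℂ
  continuousOn_log₀ : ContinuousOn log₀ (pathDomain openStart openEnd)
  continuousOn_log₁ : ContinuousOn log₁ (pathDomain openStart openEnd)
  continuousOn_logₜ :
    ContinuousOn (fun p : ℝ × ℂ => logₜ p.1 p.2) (pathDomain openStart openEnd ×ˢ U)
  exp_log₀ : 0 ∈ fixedSingularities J →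
    ∀ s ∈ pathDomain openStart openEnd, Complex.exp (log₀ s) = toFun s
  exp_log₁ : 1 ∈ fixedSingularities J →
    ∀ s ∈ pathDomain openStart openEnd, Complex.exp (log₁ s) = 1 - toFun s
  exp_logₜ : J = PainleveType.VI →
    ∀ s ∈ pathDomain openStart openEnd, ∀ t ∈ U, Complex.exp (logₜ s t) = t - toFun s

namespace TwistedPath

variable {J : PainleveType} {U : Set ℂ}

/-- The value `ρ_J(γ(s), t)` of the chosen branch. -/
def weight (γ : TwistedPath J U) (q : Params) (s : ℝ) (t : ℂ) : ℂ :=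
  masterFunction J q t (γ.toFun s) (γ.log₀ s) (γ.log₁ s) (γ.logₜ s t)

/-- The pulled back integrand `γ(s)^k ρ_J(γ(s), t) γ'(s)` of the `k`-th moment. -/
def integrand (γ : TwistedPath J U) (q : Params) (k : ℕ) (s : ℝ) (t : ℂ) : ℂ :=
  γ.toFun s ^ k * γ.weight q s t * deriv γ.toFun s

/-- `∫_γ u^k ρ_J(u, t) du`. -/
def moment (γ : TwistedPath J U) (q : Params) (k : ℕ) (t : ℂ) : ℂ :=
  ∫ s in Set.Ioo (0 : ℝ) 1, γ.integrand q k s t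

open Classical in
/-- The coefficient at the point `p` of the twisted boundary of `γ` at time `t`, where the fibre at
`p` of the rank one local system of branches of `ρ_J` is identified with `ℂ` by evaluation. -/
def boundaryAt (γ : TwistedPath J U) (q : Params) (t p : ℂ) : ℂ :=
  (if γ.openEnd = false ∧ γ.toFun 1 = p then γ.weight q 1 t else 0)
    - (if γ.openStart = false ∧ γ.toFun 0 = p then γ.weight q 0 t else 0)

end TwistedPath

/-- A twisted 1-chain for type `J` over the set of times `U`: a finite formal complex linear
combination of paths with branches. -/
structure TwistedChain (J : PainleveType) (U : Set ℂ) where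
  size : ℕ
  coeff : Fin size → ℂ
  path : Fin size → TwistedPath J U

namespace TwistedChain

variable {J : PainleveType} {U : Set ℂ}

/-- The chain is a cycle: its twisted boundary vanishes. -/
def IsCycle (Γ : TwistedChain J U) (q : Params) : Prop :=
  ∀ t ∈ U, ∀ p : ℂ, ∑ j, Γ.coeff j * (Γ.path j).boundaryAt q t p = 0

/-- The integrals of the moments of order `< N` over the chain converge absolutely, locally
uniformly in `t ∈ U`. (This is automatic if no path has an open end.) -/
def MomentsConverge (Γ : TwistedChain J U) (q : Params) (N : ℕ) : Prop :=
  ∀ j, ∀ k < N, ∀ t₀ ∈ U, ∃ V ∈ 𝓝 t₀, ∃ g : ℝ → ℝ,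
    MeasureTheory.IntegrableOn g (Set.Ioo (0 : ℝ) 1) ∧
    ∀ t ∈ V, ∀ s ∈ Set.Ioo (0 : ℝ) 1, ‖(Γ.path j).integrand q k s t‖ ≤ g s

/-- The moment `τ_J^{(k)}(t) = ∫_Γ u^k ρ_J(u, t) du`. -/
def tau (Γ : TwistedChain J U) (q : Params) (k : ℕ) (t : ℂ) : ℂ :=
  ∑ j, Γ.coeff j * (Γ.path j).moment q k t

/-- The determinant `P_m^J(x, t)`: its first `m` rows are `(τ^{(i + j)}(t))_j`, `0 ≤ i < m`, and
its last row is `(1, x, …, x^m)`. -/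
def detFormula (Γ : TwistedChain J U) (q : Params) (m : ℕ) (x t : ℂ) : ℂ :=
  Matrix.det (Matrix.of fun i j : Fin (m + 1) =>
    if (i : ℕ) < m then Γ.tau q (i + j) t else x ^ (j : ℕ))

end TwistedChain

end

end QuantumPainleve

/-! ### Jacobi's formula in terms of row replacements. -/

namespace PainleveHankel

open Polynomial Matrix

/-! Let `Λ` be the functional `X ^ k ↦ τ k` and `ν n = Λ ((X - x) ^ n)`. Unipotent row and column
operations turn `P_m` into `(-1) ^ m * det (ν (i + j + 1))` (`orthogonalDet_eq`). Since `dν n / dx =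
-n ν (n - 1)`, Jacobi's formula writes `P_m'` and `P_m''` as sums over row replacements in this
Hankel matrix; nearly all terms vanish, because the new row is a multiple of another row.

For the time derivative, an exact form `d(S u ^ k ρ)` is added to `(u - x) u ^ k ∂ₜρ du`, where `S`
vanishes at the fixed singular points. On a cycle this gives `Λ' ((X - x) f) = Λ (Q f' + R f)`, with
`Λ'` the functional of the derivatives `τ'`, `deg Q ≤ 2` and `deg R ≤ 1` (`tau_relation`). For `f =
(X - x) ^ n`, expanding `Q` and `R` at `x` expresses `∂ₜ ν (n + 1)` through the `ν`'s. The row sums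
that appear are those of `P_m`, `P_m'`, `P_m''`, and two more that are evaluated directly, so that
`∂ₜ P_m = -Q(x) P_m'' - R(x) P_m' + (m r₁ + m (m - 1) q₂) P_m` (`hasDerivAt_orthogonalDet_time`).
The derivative terms are those of the Hamiltonian for all parameters; the condition on the
parameters only serves the term of order zero (`hamiltonian_eq`).

The analytic points are a Cauchy estimate, which lets domination of the integrands suffice for
differentiation under the integral, and the vanishing of boundary terms at open ends
(`eq_zero_of_tendsto_primitive`). -/

/-- The sum over `i` of the determinants of `A` with the row `i` replaced by the row `i` of `G`. -/
noncomputable def rowSum {m : ℕ} (A G : Matrix (Fin m) (Fin m) ℂ) : ℂ :=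
  ∑ i, (A.updateRow i (G i)).det

section rowSum

variable {m : ℕ}

/-- Cramer's rule. The trace form makes linearity in `G` and invariance under transposition
immediate, so rows and columns may be exchanged freely. -/
theorem rowSum_eq_trace (A G : Matrix (Fin m) (Fin m) ℂ) :
    rowSum A G = (A.adjugate * G).trace := by
  have h : ∀ i, (A.updateRow i (G i)).det = (G * A.adjugate) i i := by
    intro i
    rw [← det_transpose, ← updateCol_transpose, ← cramer_apply, cramer_eq_adjugate_mulVec,
      ← adjugate_transpose]
    simp [mulVec, dotProduct, Matrix.mul_apply, mul_comm]
  rw [Matrix.trace_mul_comm]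
  exact Finset.sum_congr rfl fun i _ => h i

theorem rowSum_transpose (A G : Matrix (Fin m) (Fin m) ℂ) : rowSum Aᵀ Gᵀ = rowSum A G := by
  rw [rowSum_eq_trace, rowSum_eq_trace, ← adjugate_transpose, ← transpose_mul, trace_transpose,
    trace_mul_comm]

theorem rowSum_add (A G G' : Matrix (Fin m) (Fin m) ℂ) :
    rowSum A (G + G') = rowSum A G + rowSum A G' := by
  simp [rowSum_eq_trace, mul_add]

theorem rowSum_smul (A G : Matrix (Fin m) (Fin m) ℂ) (c : ℂ) :
    rowSum A (c • G) = c * rowSum A G := by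
  simp [rowSum_eq_trace]

theorem rowSum_self (A : Matrix (Fin m) (Fin m) ℂ) : rowSum A A = m * A.det := by
  simp [rowSum]

theorem det_updateRow_eq_zero_of_smul (A : Matrix (Fin m) (Fin m) ℂ) (i : Fin m)
    (v : Fin m → ℂ) (h : v = 0 ∨ ∃ k, k ≠ i ∧ ∃ c : ℂ, v = c • A k) :
    (A.updateRow i v).det = 0 := by
  rcases h with rfl | ⟨k, hk, c, rfl⟩
  · exact det_eq_zero_of_row_eq_zero i (by simp)
  · rw [det_updateRow_smul, det_updateRow_eq_zero hk, mul_zero]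

/-- Jacobi's formula for the derivative of a determinant. -/
theorem hasDerivAt_det {A : ℂ → Matrix (Fin m) (Fin m) ℂ} {A' : Matrix (Fin m) (Fin m) ℂ} {s : ℂ}
    (h : ∀ i j, HasDerivAt (fun y => A y i j) (A' i j) s) :
    HasDerivAt (fun y => (A y).det) (rowSum (A s) A') s := by
  -- The product rule on the Leibniz formula for `det_apply'` differentiates column by column, hence
  -- the passage to the transpose.
  rw [← rowSum_transpose]
  have key : HasDerivAt (fun y => (A y).det)
      (∑ σ : Equiv.Perm (Fin m), ((Equiv.Perm.sign σ : ℤ) : ℂ) *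
        ∑ i, (∏ j ∈ Finset.univ.erase i, A s (σ j) j) • A' (σ i) i) s := by
    simp_rw [det_apply']
    refine HasDerivAt.fun_sum fun σ _ => HasDerivAt.const_mul _ ?_
    exact HasDerivAt.fun_finsetProd fun i _ => h (σ i) i
  convert key using 1
  simp_rw [Finset.mul_sum, rowSum]
  rw [Finset.sum_comm]
  refine Finset.sum_congr rfl fun i _ => ?_
  rw [← det_transpose, det_apply']
  refine Finset.sum_congr rfl fun σ _ => ?_
  congr 1
  rw [← Finset.mul_prod_erase _ _ (Finset.mem_univ i), smul_eq_mul, mul_comm]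
  congr 1
  · refine Finset.prod_congr rfl fun j hj => ?_
    simp [updateRow_apply, Finset.ne_of_mem_erase hj]
  · simp

end rowSum

/-! ### Row sums of Hankel matrices and their derivatives. -/

/-- The Hankel matrix `(ν (i + j + 1))`. -/
def hankel (m : ℕ) (ν : ℕ → ℂ) : Matrix (Fin m) (Fin m) ℂ :=
  of fun i j => ν (i + j + 1)

theorem two_mul_sum_range_cast (m : ℕ) :
    2 * ∑ i ∈ Finset.range m, (i : ℂ) = m * (m - 1) := by
  induction m with
  | zero => simp
  | succ n ih =>
    rw [Finset.sum_range_succ, mul_add, ih]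
    push_cast; ring

section hankel

variable {m : ℕ}

/-- The Hankel matrix is symmetric, so the contributions of the factors `i` and `j` agree. With the
factor `i` alone, each replacement row is a scalar multiple of a row of `f (i + j)`. -/
theorem rowSum_hankel_natCast_mul (ν : ℕ → ℂ) (f : ℕ → ℂ) :
    rowSum (hankel m ν) (of fun i j : Fin m => ((i + j : ℕ) : ℂ) * f (i + j)) =
      2 * rowSum (hankel m ν) (of fun i j : Fin m => ((i : ℕ) : ℂ) * f (i + j)) := by
  have h1 : (of fun i j : Fin m => ((i + j : ℕ) : ℂ) * f (i + j)) =
      (of fun i j : Fin m => ((i : ℕ) : ℂ) * f (i + j)) +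
      (of fun i j : Fin m => ((i : ℕ) : ℂ) * f (i + j))ᵀ := by
    ext i j
    simp [add_mul, add_comm (j : ℕ)]
  have h2 : (hankel m ν)ᵀ = hankel m ν := by
    ext i j
    simp [hankel, add_comm (j : ℕ)]
  rw [h1, rowSum_add]
  nth_rewrite 2 [← h2]
  rw [rowSum_transpose, two_mul]

/-- After halving by symmetry, the new row `i` is `i` times row `i - 1`, and row `0` is zero. -/
theorem rowSum_hankel_index_mul_pred (ν : ℕ → ℂ) :
    rowSum (hankel m ν) (of fun i j : Fin m => ((i + j : ℕ) : ℂ) * ν (i + j)) = 0 := by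
  rw [rowSum_hankel_natCast_mul, rowSum, Finset.sum_eq_zero, mul_zero]
  rintro ⟨i, hi⟩ _
  apply det_updateRow_eq_zero_of_smul
  rcases i with _ | i
  · left; ext j; simp
  · right
    refine ⟨⟨i, by omega⟩, by simp, (i + 1 : ℕ), ?_⟩
    ext j
    simp [hankel, add_right_comm]

theorem rowSum_hankel_index_mul (ν : ℕ → ℂ) :
    rowSum (hankel m ν) (of fun i j : Fin m => ((i + j : ℕ) : ℂ) * ν (i + j + 1)) =
      m * (m - 1) * (hankel m ν).det := by
  rw [rowSum_hankel_natCast_mul ν fun n => ν (n + 1), rowSum]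
  have h : ∀ i : Fin m, ((hankel m ν).updateRow i
      ((of fun i j : Fin m => ((i : ℕ) : ℂ) * ν (i + j + 1)) i)).det =
      (i : ℕ) * (hankel m ν).det := by
    intro i
    have : (of fun i j : Fin m => ((i : ℕ) : ℂ) * ν (i + j + 1)) i =
        ((i : ℕ) : ℂ) • hankel m ν i := by
      ext j; simp [hankel]
    rw [this, det_updateRow_smul, updateRow_eq_self]
  simp_rw [h]
  rw [← Finset.sum_mul, Fin.sum_univ_eq_sum_range (fun i => (i : ℂ)) m, ← mul_assoc,
    two_mul_sum_range_cast]

theorem hasDerivAt_det_hankel {ν : ℂ → ℕ → ℂ} {x : ℂ}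
    (hν : ∀ n, HasDerivAt (fun y => ν y n) (-(n * ν x (n - 1))) x) :
    HasDerivAt (fun y => (hankel m (ν y)).det)
      (-rowSum (hankel m (ν x)) (of fun i j : Fin m => ν x (i + j))) x := by
  convert hasDerivAt_det (A := fun y => hankel m (ν y)) (fun i j : Fin m => hν (i + j + 1)) using 1
  -- The factor `i + j + 1` is split as `(i + j) + 1`; the first summand has row sum zero.
  have h : (fun i j : Fin m => -(((i + j + 1 : ℕ) : ℂ) * ν x (i + j + 1 - 1))) =
      (-1 : ℂ) • (of fun i j : Fin m => ((i + j : ℕ) : ℂ) * ν x (i + j)) +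
      (-1 : ℂ) • (of fun i j : Fin m => ν x (i + j)) := by
    ext i j
    simp; ring
  erw [h]
  rw [rowSum_add, rowSum_smul, rowSum_smul, rowSum_hankel_index_mul_pred]
  ring

theorem rowSum_hankel_pred (n : ℕ) (ν : ℕ → ℂ) :
    rowSum (hankel (n + 1) ν) (of fun i j : Fin (n + 1) => ν (i + j)) =
      ((hankel (n + 1) ν).updateRow 0 fun j => ν j).det := by
  rw [rowSum, Fin.sum_univ_succ, Finset.sum_eq_zero, add_zero]
  · congr 2; ext j; simp
  · intro i _
    apply det_updateRow_eq_zero_of_smul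
    right
    refine ⟨i.castSucc, (Fin.castSucc_lt_succ).ne, 1, ?_⟩
    ext j
    simp [hankel, add_right_comm]

/-- With the factor `i` alone, row `0` is zero and each row `i ≥ 2` is a multiple of row `i - 2`;
only row `1` contributes. -/
theorem rowSum_hankel_index_mul_pred_pred (n : ℕ) (ν : ℕ → ℂ) :
    rowSum (hankel (n + 2) ν)
        (of fun i j : Fin (n + 2) => ((i + j : ℕ) : ℂ) * ν (i + j - 1)) =
      2 * ((hankel (n + 2) ν).updateRow 1 fun j => ν j).det := by
  rw [rowSum_hankel_natCast_mul ν fun n => ν (n - 1), rowSum, Fin.sum_univ_succ,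
    Fin.sum_univ_succ, Finset.sum_eq_zero, add_zero, det_updateRow_eq_zero_of_smul, zero_add]
  · congr 3; ext j; simp
  · left; ext j; simp
  · intro i _
    apply det_updateRow_eq_zero_of_smul
    right
    refine ⟨i.castSucc.castSucc, ?_, ((i + 2 : ℕ) : ℂ), ?_⟩
    · intro h
      have := congrArg Fin.val h
      simp at this
      omega
    ext j
    have h : (i.succ.succ : ℕ) + j - 1 = i + j + 1 := by simp; omega
    rw [of_apply, h]
    simp [hankel, add_assoc, one_add_one_eq_two]

/-- The row sum is a single determinant, with rows `ν j, ν (j + 2), ν (j + 3), …`. In its derivative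
the row part of the index factor survives only in row `1`, and the column part cancels altogether.
-/
theorem hasDerivAt_rowSum_hankel_pred {ν : ℂ → ℕ → ℂ} {x : ℂ}
    (hν : ∀ n, HasDerivAt (fun y => ν y n) (-(n * ν x (n - 1))) x) :
    HasDerivAt (fun y => rowSum (hankel m (ν y)) (of fun i j : Fin m => ν y (i + j)))
      (rowSum (hankel m (ν x)) (of fun i j : Fin m => ((i + j : ℕ) : ℂ) * ν x (i + j - 1))) x := by
  match m with
  | 0 => simpa [rowSum] using hasDerivAt_const x (0 : ℂ)
  | 1 => simpa [rowSum] using hν 0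
  | n + 2 =>
    rw [rowSum_hankel_index_mul_pred_pred]
    simp_rw [rowSum_hankel_pred]
    set H₁ : ℂ → Matrix (Fin (n + 2)) (Fin (n + 2)) ℂ :=
      fun y => (hankel (n + 2) (ν y)).updateRow 0 fun j => ν y j with hH₁
    -- The factor `i + j + 1` is split into `i + 1` (in `G`, by rows) and `j` (in `K`, by columns);
    -- row `0` has been replaced, its factor is `j` alone and goes to `K`.
    let G : Matrix (Fin (n + 2)) (Fin (n + 2)) ℂ :=
      of fun i j => if i = 0 then 0 else -((i : ℂ) + 1) * ν x (i + j)
    let K : Matrix (Fin (n + 2)) (Fin (n + 2)) ℂ :=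
      of fun i j => if i = 0 then -(j * ν x (j - 1)) else -(j : ℂ) * ν x (i + j)
    have hd := hasDerivAt_det (A := H₁) (A' := G + K) (s := x) (by
      intro i j
      by_cases hi : i = 0
      · subst hi
        simpa [hH₁, G, K] using hν j
      · simp only [hH₁, updateRow_ne hi, hankel, of_apply, G, K, hi, if_false, Matrix.add_apply]
        convert hν (i + j + 1) using 1
        push_cast
        ring)
    convert hd using 1
    -- Column `j` of `K` is `-j` times column `j - 1` of `H₁ x`.
    have hK : rowSum (H₁ x) K = 0 := by
      rw [← rowSum_transpose, rowSum, Finset.sum_eq_zero]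
      rintro ⟨j, hj⟩ _
      apply det_updateRow_eq_zero_of_smul
      rcases j with _ | j
      · left; ext i; simp [K]
      · right
        refine ⟨⟨j, by omega⟩, by simp, -((j + 1 : ℕ) : ℂ), ?_⟩
        ext i
        by_cases hi : i = 0
        · subst hi; simp [K, hH₁]; ring
        · simp [K, hH₁, hi, hankel, add_assoc]; ring
    have hG0 : ((H₁ x).updateRow 0 (G 0)).det = 0 :=
      det_updateRow_eq_zero_of_smul _ _ _ (Or.inl (by ext j; simp [G]))
    have hG1 : G (Fin.succ 0) = (-2 : ℂ) • hankel (n + 2) (ν x) 0 := by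
      ext j
      simp [G, hankel, add_comm]
      ring
    -- The two matrices differ by the exchange of rows `0` and `1`; its sign turns the factor `-2`
    -- of `hG1` into the required `2`.
    have hswap : (H₁ x).updateRow (Fin.succ 0) (hankel (n + 2) (ν x) 0) =
        ((hankel (n + 2) (ν x)).updateRow 1 fun j => ν x j).submatrix (Equiv.swap 0 1) id := by
      ext i j
      by_cases h0 : i = 0
      · subst h0; simp [hH₁, updateRow_apply]
      · by_cases h1 : i = 1
        · subst h1; simp
        · rw [submatrix_apply, Equiv.swap_apply_of_ne_of_ne h0 h1]
          simp [hH₁, updateRow_apply, h0, h1]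
    rw [rowSum_add, hK, add_zero, rowSum, Fin.sum_univ_succ, Fin.sum_univ_succ,
      Finset.sum_eq_zero, add_zero, hG0, zero_add, hG1, det_updateRow_smul, hswap, det_permute]
    · simp
    · intro i _
      apply det_updateRow_eq_zero_of_smul
      right
      refine ⟨i.succ.castSucc, (Fin.castSucc_lt_succ).ne, -((i : ℂ) + 3), ?_⟩
      ext j
      have h0 : i.succ.castSucc ≠ 0 := by simp [Fin.ext_iff]
      simp only [G, hH₁, hankel, updateRow_ne h0, of_apply, Pi.smul_apply, smul_eq_mul,
        Fin.succ_ne_zero, if_false]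
      have h1 : (i.succ.succ : ℕ) + j = (i.succ.castSucc : ℕ) + j + 1 := by simp; omega
      rw [h1]
      simp
      left; ring

end hankel

end PainleveHankel

/-! ### The moment functional and the differential equation of the determinant. -/

namespace PainleveHankel

open Polynomial Matrix

/-- The linear functional `X ^ k ↦ τ k` (`k < N`), `X ^ k ↦ 0` (`k ≥ N`) on polynomials. -/
noncomputable def momentFunctional (N : ℕ) (τ : ℕ → ℂ) : ℂ[X] →ₗ[ℂ] ℂ :=
  ∑ k ∈ Finset.range N, τ k • lcoeff ℂ k

theorem momentFunctional_apply (N : ℕ) (τ : ℕ → ℂ) (f : ℂ[X]) :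
    momentFunctional N τ f = ∑ k ∈ Finset.range N, τ k * f.coeff k := by
  simp [momentFunctional]

theorem momentFunctional_X_pow {N k : ℕ} (τ : ℕ → ℂ) (hk : k < N) :
    momentFunctional N τ (X ^ k) = τ k := by
  simp [momentFunctional_apply, coeff_X_pow, hk]

theorem hasDerivAt_momentFunctional {N : ℕ} {τ : ℂ → ℕ → ℂ} {τ' : ℕ → ℂ} {t : ℂ}
    (hτ : ∀ k < N, HasDerivAt (fun s => τ s k) (τ' k) t) (f : ℂ[X]) :
    HasDerivAt (fun s => momentFunctional N (τ s) f) (momentFunctional N τ' f) t := by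
  simp_rw [momentFunctional_apply]
  exact HasDerivAt.fun_sum fun k hk => (hτ k (Finset.mem_range.1 hk)).mul_const _

theorem linearMap_monomial (Φ : ℂ[X] →ₗ[ℂ] ℂ) (k : ℕ) (c : ℂ) :
    Φ (monomial k c) = c * Φ (X ^ k) := by
  rw [← smul_eq_mul, ← map_smul, smul_eq_C_mul, C_mul_X_pow_eq_monomial]

theorem linearMap_eq_of_eq_X_pow {N : ℕ} {Φ Ψ : ℂ[X] →ₗ[ℂ] ℂ}
    (h : ∀ k < N, Φ (X ^ k) = Ψ (X ^ k)) {f : ℂ[X]} (hf : f.natDegree < N) : Φ f = Ψ f := by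
  rw [f.as_sum_range' N hf, map_sum, map_sum]
  refine Finset.sum_congr rfl fun k hk => ?_
  rw [linearMap_monomial, linearMap_monomial, h k (Finset.mem_range.1 hk)]

/-- Differentiation under `Φ`. The induction varies `Φ`, since splitting off one factor `X - C y`
replaces `Φ` by `Φ (X * ·)`. -/
theorem hasDerivAt_linearMap_X_sub_C_pow (Φ : ℂ[X] →ₗ[ℂ] ℂ) (n : ℕ) (x : ℂ) :
    HasDerivAt (fun y => Φ ((X - C y) ^ n)) (-(n * Φ ((X - C x) ^ (n - 1)))) x := by
  induction n generalizing Φ with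
  | zero => simpa using hasDerivAt_const x (Φ 1)
  | succ n ih =>
    have h : ∀ k y, Φ ((X - C y) ^ (k + 1)) =
        Φ (X * (X - C y) ^ k) - y * Φ ((X - C y) ^ k) := by
      intro k y
      rw [← smul_eq_mul y, ← map_smul, ← map_sub, smul_eq_C_mul, ← sub_mul, pow_succ']
    simp_rw [h]
    refine ((ih (Φ ∘ₗ LinearMap.mulLeft ℂ X)).fun_sub
      ((hasDerivAt_id x).fun_mul (ih Φ))).congr_deriv ?_
    rcases n with _ | n
    · simp
    · simp only [Nat.add_sub_cancel, LinearMap.comp_apply, LinearMap.mulLeft_apply, id, h n x]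
      push_cast
      ring

/-- The determinant whose first `m` rows are `(τ (i + j))_j`, `i < m`, and whose last row is
`(1, x, …, x ^ m)`. -/
noncomputable def orthogonalDet (m : ℕ) (τ : ℕ → ℂ) (x : ℂ) : ℂ :=
  det (of fun i j : Fin (m + 1) => if (i : ℕ) < m then τ (i + j) else x ^ (j : ℕ))

/-- The shifted moments: the values of the moment functional at `(X - x) ^ n`. -/
noncomputable def shiftedMoment (N : ℕ) (τ : ℕ → ℂ) (x : ℂ) (n : ℕ) : ℂ :=
  momentFunctional N τ ((X - C x) ^ n)

/-- Passing from the basis `X ^ j` to `(X - x) ^ j` in the columns makes the last row `(1, 0, …,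
0)`. Expanding along it leaves the minor `Λ (X ^ i (X - x) ^ (j + 1))`, and the same unipotent
change in the rows makes it Hankel. Only degrees up to `2 * m - 1` occur, so the truncation of `Λ`
is harmless. -/
theorem orthogonalDet_eq (m : ℕ) (τ : ℕ → ℂ) (x : ℂ) :
    orthogonalDet m τ x = (-1) ^ m * (hankel m (shiftedMoment (2 * m) τ x)).det := by
  have hdeg : ∀ n, ((X - C x) ^ n : ℂ[X]).natDegree = n := by
    intro n; simp [natDegree_pow]
  have hmonic : ∀ n, ((X - C x) ^ n : ℂ[X]).Monic := fun n => (monic_X_sub_C x).pow n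
  set M : Matrix (Fin (m + 1)) (Fin (m + 1)) ℂ :=
    of fun i j : Fin (m + 1) => if (i : ℕ) < m then τ (i + j) else x ^ (j : ℕ) with hM
  let B : ∀ n, Matrix (Fin n) (Fin n) ℂ :=
    fun n => of fun k j : Fin n => ((X - C x) ^ (j : ℕ) : ℂ[X]).coeff k
  have hB : ∀ n, (B n).det = 1 := fun n =>
    det_matrixOfPolynomials _ (fun i => hdeg i) fun i => hmonic i
  have hexp : ∀ n, ∀ j : Fin n, ∀ Φ : ℂ[X] →ₗ[ℂ] ℂ,
      Φ ((X - C x) ^ (j : ℕ)) = ∑ k : Fin n, Φ (X ^ (k : ℕ)) * B n k j := by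
    intro n j Φ
    rw [((X - C x) ^ (j : ℕ) : ℂ[X]).as_sum_range' n (by rw [hdeg]; exact j.2), map_sum,
      ← Fin.sum_univ_eq_sum_range
        (fun i => Φ (monomial i (((X - C x) ^ (j : ℕ) : ℂ[X]).coeff i)))]
    refine Finset.sum_congr rfl fun k _ => ?_
    rw [linearMap_monomial, mul_comm]
    rfl
  set Λ := momentFunctional (2 * m) τ with hΛ
  have hrow : ∀ i : Fin m, ∀ j : Fin (m + 1),
      (M * B (m + 1)) i.castSucc j = Λ (X ^ (i : ℕ) * (X - C x) ^ (j : ℕ)) := by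
    intro i j
    have := hexp (m + 1) j (Λ ∘ₗ LinearMap.mulLeft ℂ (X ^ (i : ℕ)))
    simp only [LinearMap.comp_apply, LinearMap.mulLeft_apply, ← pow_add] at this
    rw [this, Matrix.mul_apply]
    refine Finset.sum_congr rfl fun k _ => ?_
    rw [hΛ, momentFunctional_X_pow]
    · simp [hM]
    · have := i.2; have := k.2; omega
  have hlast : ∀ j : Fin (m + 1), (M * B (m + 1)) (Fin.last m) j = 0 ^ (j : ℕ) := by
    intro j
    have := hexp (m + 1) j (leval x)
    simp only [leval_apply, eval_pow, eval_sub, eval_X, eval_C, sub_self] at this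
    rw [this, Matrix.mul_apply]
    refine Finset.sum_congr rfl fun k _ => ?_
    simp [hM]
  have hminor : (B m)ᵀ * (M * B (m + 1)).submatrix Fin.castSucc Fin.succ =
      hankel m (shiftedMoment (2 * m) τ x) := by
    ext i j
    have := hexp m i (Λ ∘ₗ LinearMap.mulLeft ℂ ((X - C x) ^ ((j : ℕ) + 1)))
    simp only [LinearMap.comp_apply, LinearMap.mulLeft_apply] at this
    rw [Matrix.mul_apply, hankel, of_apply, shiftedMoment, add_assoc,
      add_comm (i : ℕ), pow_add, ← hΛ, this]
    refine Finset.sum_congr rfl fun k _ => ?_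
    rw [submatrix_apply, hrow, transpose_apply, mul_comm, mul_comm (X ^ (k : ℕ))]
    simp
  calc orthogonalDet m τ x = (M * B (m + 1)).det := by rw [det_mul, hB, mul_one]; rfl
    _ = (-1) ^ m * ((M * B (m + 1)).submatrix Fin.castSucc Fin.succ).det := by
      rw [det_succ_row _ (Fin.last m), Fin.sum_univ_succ, Finset.sum_eq_zero]
      · rw [hlast]; simp
      · intro j _; rw [hlast]; simp
    _ = _ := by rw [← hminor, det_mul, det_transpose, hB, one_mul]

section derivatives

variable {m : ℕ}

theorem hasDerivAt_shiftedMoment (N : ℕ) (τ : ℕ → ℂ) (x : ℂ) (n : ℕ) :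
    HasDerivAt (fun y => shiftedMoment N τ y n) (-(n * shiftedMoment N τ x (n - 1))) x :=
  hasDerivAt_linearMap_X_sub_C_pow _ n x

theorem hasDerivAt_orthogonalDet (τ : ℕ → ℂ) (x : ℂ) :
    HasDerivAt (orthogonalDet m τ) ((-1) ^ m * -rowSum (hankel m (shiftedMoment (2 * m) τ x))
      (of fun i j : Fin m => shiftedMoment (2 * m) τ x (i + j))) x := by
  rw [funext (orthogonalDet_eq m τ)]
  exact (hasDerivAt_det_hankel (hasDerivAt_shiftedMoment _ τ x)).const_mul _

theorem deriv_deriv_orthogonalDet (τ : ℕ → ℂ) (x : ℂ) :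
    deriv (deriv (orthogonalDet m τ)) x =
      (-1) ^ m * -rowSum (hankel m (shiftedMoment (2 * m) τ x))
        (of fun i j : Fin m => ((i + j : ℕ) : ℂ) * shiftedMoment (2 * m) τ x (i + j - 1)) := by
  rw [funext fun y => (hasDerivAt_orthogonalDet (m := m) τ y).deriv]
  exact ((hasDerivAt_rowSum_hankel_pred (hasDerivAt_shiftedMoment _ τ x)).neg.const_mul _).deriv

/-- A first order relation for the derivatives of the shifted moments, from the relation for the
moments. -/
theorem momentFunctional_deriv_eq {N : ℕ} {τ τ' : ℕ → ℂ} {x q₀ q₁ q₂ r₀ r₁ : ℂ}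
    (hrel : ∀ k, k + 1 < N → τ' (k + 1) - x * τ' k =
      k * q₀ * τ (k - 1) + (k * q₁ + r₀) * τ k + (k * q₂ + r₁) * τ (k + 1))
    {n : ℕ} (hn : n + 1 < N) :
    shiftedMoment N τ' x (n + 1) =
      (q₀ + q₁ * x + q₂ * x ^ 2) * (n * shiftedMoment N τ x (n - 1))
        + (r₀ + r₁ * x) * shiftedMoment N τ x n + r₁ * shiftedMoment N τ x (n + 1)
        + (q₁ + 2 * q₂ * x) * (n * shiftedMoment N τ x n)
        + q₂ * (n * shiftedMoment N τ x (n + 1)) := by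
  let Φ : ℂ[X] →ₗ[ℂ] ℂ := momentFunctional N τ' ∘ₗ LinearMap.mulLeft ℂ (X - C x)
  let Ψ : ℂ[X] →ₗ[ℂ] ℂ := momentFunctional N τ ∘ₗ
    (LinearMap.mulLeft ℂ (C q₀ + C q₁ * X + C q₂ * X ^ 2) ∘ₗ derivative +
      LinearMap.mulLeft ℂ (C r₀ + C r₁ * X))
  -- This is `Λ' ((X - x) f) = Λ (Q f' + R f)`, checked on monomials. The bound is `N - 1` because
  -- both sides raise the degree by one.
  have key : Φ ((X - C x) ^ n) = Ψ ((X - C x) ^ n) := by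
    refine linearMap_eq_of_eq_X_pow (N := N - 1) (fun k hk => ?_)
      (by simp [natDegree_pow]; omega)
    have h1 : Φ (X ^ k) = τ' (k + 1) - x * τ' k := by
      simp only [Φ, LinearMap.comp_apply, LinearMap.mulLeft_apply]
      rw [sub_mul, ← pow_succ', ← smul_eq_C_mul, map_sub, map_smul,
        momentFunctional_X_pow _ (by omega), momentFunctional_X_pow _ (by omega), smul_eq_mul]
    have h2 : Ψ (X ^ k) = k * q₀ * τ (k - 1) + (k * q₁ + r₀) * τ k
        + (k * q₂ + r₁) * τ (k + 1) := by
      have e : (C q₀ + C q₁ * X + C q₂ * X ^ 2) * derivative (X ^ k : ℂ[X])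
          + (C r₀ + C r₁ * X) * X ^ k = (k * q₀) • X ^ (k - 1) + (k * q₁ + r₀) • X ^ k
          + (k * q₂ + r₁) • X ^ (k + 1) := by
        simp only [smul_eq_C_mul, map_add, map_mul, derivative_X_pow, map_natCast]
        rcases k with _ | k
        · simp
        · simp only [Nat.add_sub_cancel]; ring
      simp only [Ψ, LinearMap.comp_apply, LinearMap.add_apply, LinearMap.mulLeft_apply]
      rw [e, map_add, map_add, map_smul, map_smul, map_smul,
        momentFunctional_X_pow _ (by omega), momentFunctional_X_pow _ (by omega),
        momentFunctional_X_pow _ (by omega)]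
      simp only [smul_eq_mul]
    rw [h1, h2, hrel k (by omega)]
  have h1 : Φ ((X - C x) ^ n) = shiftedMoment N τ' x (n + 1) := by
    simp only [Φ, LinearMap.comp_apply, LinearMap.mulLeft_apply, shiftedMoment, pow_succ']
  rw [← h1, key]
  -- Taylor expansion of `Q` and `R` at `x`, in powers of `X - C x`.
  have e : (C q₀ + C q₁ * X + C q₂ * X ^ 2) * derivative ((X - C x) ^ n)
      + (C r₀ + C r₁ * X) * (X - C x) ^ n =
      ((q₀ + q₁ * x + q₂ * x ^ 2) * n) • (X - C x) ^ (n - 1) +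
      (r₀ + r₁ * x) • (X - C x) ^ n + r₁ • (X - C x) ^ (n + 1) +
      ((q₁ + 2 * q₂ * x) * n) • (X - C x) ^ n + (q₂ * n) • (X - C x) ^ (n + 1) := by
    simp only [smul_eq_C_mul, map_add, map_mul, map_pow, derivative_X_sub_C_pow, map_natCast,
      C_ofNat]
    rcases n with _ | n
    · simp; ring
    · simp only [Nat.add_sub_cancel]; push_cast; ring
  simp only [Ψ, LinearMap.comp_apply, LinearMap.add_apply, LinearMap.mulLeft_apply]
  rw [e]
  simp only [map_add, map_smul, smul_eq_mul, shiftedMoment]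
  ring

/-- If the moments `τ k` satisfy a first order relation, then the determinant satisfies a second
order differential equation. -/
theorem hasDerivAt_orthogonalDet_time {τ : ℂ → ℕ → ℂ} {τ' : ℕ → ℂ} {t x q₀ q₁ q₂ r₀ r₁ : ℂ}
    (hτ : ∀ k < 2 * m, HasDerivAt (fun s => τ s k) (τ' k) t)
    (hrel : ∀ k, k + 1 < 2 * m → τ' (k + 1) - x * τ' k =
      k * q₀ * τ t (k - 1) + (k * q₁ + r₀) * τ t k + (k * q₂ + r₁) * τ t (k + 1)) :
    HasDerivAt (fun s => orthogonalDet m (τ s) x)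
      (-(q₀ + q₁ * x + q₂ * x ^ 2) * deriv (deriv (orthogonalDet m (τ t))) x
        - (r₀ + r₁ * x) * deriv (orthogonalDet m (τ t)) x
        + (m * r₁ + m * (m - 1) * q₂) * orthogonalDet m (τ t) x) t := by
  set ν := shiftedMoment (2 * m) (τ t) x with hν
  have h := (hasDerivAt_det (A := fun s => hankel m (shiftedMoment (2 * m) (τ s) x))
    (A' := hankel m (shiftedMoment (2 * m) τ' x)) (s := t)
    (fun i j => hasDerivAt_momentFunctional hτ _)).const_mul ((-1 : ℂ) ^ m)
  rw [funext fun s => orthogonalDet_eq m (τ s) x]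
  refine h.congr_deriv ?_
  -- Here `x` is fixed, so the coefficients may depend on it. The five row sums are, up to sign and
  -- constants, `P''`, `P'`, `m P`, `0` and `m (m - 1) P`.
  have e : hankel m (shiftedMoment (2 * m) τ' x) =
      (q₀ + q₁ * x + q₂ * x ^ 2) • (of fun i j : Fin m => ((i + j : ℕ) : ℂ) * ν (i + j - 1))
      + (r₀ + r₁ * x) • (of fun i j : Fin m => ν (i + j)) + r₁ • hankel m ν
      + (q₁ + 2 * q₂ * x) • (of fun i j : Fin m => ((i + j : ℕ) : ℂ) * ν (i + j))
      + q₂ • (of fun i j : Fin m => ((i + j : ℕ) : ℂ) * ν (i + j + 1)) := by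
    ext i j
    exact momentFunctional_deriv_eq hrel (by have := i.2; have := j.2; omega)
  rw [e, (hasDerivAt_orthogonalDet (τ t) x).deriv, deriv_deriv_orthogonalDet, orthogonalDet_eq]
  simp only [rowSum_add, rowSum_smul, rowSum_self, ← hν, rowSum_hankel_index_mul_pred,
    rowSum_hankel_index_mul]
  ring

end derivatives

end PainleveHankel

/-! ### Continuous logarithms, and limits at the ends of the unit interval. -/

section calculus

open MeasureTheory Set

/-- A continuous logarithm of a differentiable function is differentiable. -/
theorem hasDerivAt_of_exp_eventuallyEq {𝕜 : Type*} [NontriviallyNormedField 𝕜]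
    [NormedAlgebra 𝕜 ℂ] {l f : 𝕜 → ℂ} {f' : ℂ} {s : 𝕜} (hl : ContinuousAt l s)
    (hlf : ∀ᶠ y in 𝓝 s, Complex.exp (l y) = f y) (hf : HasDerivAt f f' s) :
    HasDerivAt l (f' / f s) s := by
  have hs : Complex.exp (l s) = f s := hlf.self_of_nhds
  have he := Complex.hasStrictDerivAt_exp (l s)
  have hne := Complex.exp_ne_zero (l s)
  -- By continuity, `l` agrees near `s` with a local inverse of `exp` composed with `f`.
  have hg : HasDerivAt (he.localInverse Complex.exp _ _ hne) (Complex.exp (l s))⁻¹ (f s) :=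
    hs ▸ (he.to_localInverse hne).hasDerivAt
  have h := hg.comp s hf
  rw [div_eq_inv_mul, ← hs]
  refine h.congr_of_eventuallyEq ?_
  filter_upwards [hlf, hl.eventually (he.eventually_left_inverse hne)] with y h1 h2
  rw [Function.comp_apply, ← h1, h2]

/-- A function on `(0, 1)` whose derivative is integrable near an end has a limit at that end. -/
theorem exists_tendsto_of_norm_deriv_le {f f' G : ℝ → ℂ} {e : ℝ} (he : e = 0 ∨ e = 1)
    (hf : ∀ s ∈ Ioo (0 : ℝ) 1, HasDerivAt f (f' s) s)
    (hf' : AEStronglyMeasurable f' (volume.restrict (Ioo 0 1)))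
    (hG : IntegrableOn G (Ioo 0 1)) (hle : ∀ᶠ s in 𝓝[Ioo 0 1] e, ‖f' s‖ ≤ ‖G s‖) :
    ∃ l, Tendsto f (𝓝[Ioo 0 1] e) (𝓝 l) := by
  rw [eventually_nhdsWithin_iff, Metric.eventually_nhds_iff_ball] at hle
  obtain ⟨ε, hε, hle⟩ := hle
  set W : Set ℝ := Ioo 0 1 ∩ Metric.ball e ε with hW
  have hWm : MeasurableSet W := measurableSet_Ioo.inter measurableSet_ball
  have hWc : W.OrdConnected := ordConnected_Ioo.inter (convex_ball e ε).ordConnected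
  have hint : IntegrableOn f' W :=
    Integrable.mono (hG.mono_set inter_subset_left)
      (hf'.mono_measure (Measure.restrict_mono inter_subset_left le_rfl))
      ((ae_restrict_mem hWm).mono fun s hs => hle s hs.2 hs.1)
  -- Adding the null set `{e}` gives integrability on the closed interval from `c` to `e`, where the
  -- primitive is continuous.
  have hint' : IntegrableOn f' (insert e W) := by
    rw [insert_eq]
    exact IntegrableOn.union (by simp) hint
  have heI : e ∈ Icc (0 : ℝ) 1 := by rcases he with rfl | rfl <;> simp
  have hcl : e ∈ closure (Ioo (0 : ℝ) 1) := by rwa [closure_Ioo zero_ne_one]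
  have : (𝓝[Ioo (0 : ℝ) 1] e).NeBot := mem_closure_iff_nhdsWithin_neBot.1 hcl
  have hmem : W ∈ 𝓝[Ioo 0 1] e :=
    inter_mem self_mem_nhdsWithin (mem_nhdsWithin_of_mem_nhds (Metric.ball_mem_nhds e hε))
  obtain ⟨c, hc⟩ := Filter.nonempty_of_mem hmem
  have hsub : uIcc c e ⊆ insert e W := by
    intro s hs
    by_cases hse : s = e
    · exact Or.inl hse
    right
    rw [mem_uIcc] at hs
    obtain ⟨⟨h1, h2⟩, h3⟩ := hc
    rw [Metric.mem_ball, Real.dist_eq, abs_lt] at h3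
    refine ⟨?_, ?_⟩
    · rcases hs with ⟨h4, h5⟩ | ⟨h4, h5⟩
      · exact ⟨h1.trans_le h4, (lt_of_le_of_ne h5 hse).trans_le heI.2⟩
      · exact ⟨heI.1.trans_lt (lt_of_le_of_ne h4 (Ne.symm hse)), h5.trans_lt h2⟩
    · rw [Metric.mem_ball, Real.dist_eq, abs_lt]
      rcases hs with ⟨h4, h5⟩ | ⟨h4, h5⟩ <;> constructor <;> linarith
  have hii : IntervalIntegrable f' volume c e :=
    (hint'.mono_set hsub).intervalIntegrable
  have hcont := intervalIntegral.continuousOn_primitive_interval' hii left_mem_uIcc e right_mem_uIcc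
  have heq : ∀ s ∈ W, f s = f c + ∫ y in c..s, f' y := by
    intro s hs
    have hcs : uIcc c s ⊆ W := hWc.uIcc_subset hc hs
    rw [intervalIntegral.integral_eq_sub_of_hasDerivAt (fun y hy => hf y (hcs hy).1)
      ((hint.mono_set hcs).intervalIntegrable)]
    ring
  have hev : ∀ᶠ s in 𝓝[Ioo 0 1] e, s ∈ uIcc c e := by
    obtain ⟨⟨h1, h2⟩, h3⟩ := hc
    have hce : c ≠ e := by rcases he with rfl | rfl <;> simp [h1.ne', h2.ne]
    filter_upwards [self_mem_nhdsWithin,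
      mem_nhdsWithin_of_mem_nhds (Metric.ball_mem_nhds e (dist_pos.2 hce))] with s h4 h5
    rw [Metric.mem_ball, Real.dist_eq, Real.dist_eq, abs_lt] at h5
    rcases he with rfl | rfl
    · rw [uIcc_of_ge h1.le]
      rw [sub_zero, abs_of_pos h1] at h5
      exact ⟨h4.1.le, by linarith [h5.2]⟩
    · rw [uIcc_of_le h2.le]
      rw [abs_of_neg (by linarith)] at h5
      exact ⟨by linarith [h5.1], h4.2.le⟩
  refine ⟨f c + ∫ y in c..e, f' y, ?_⟩
  have h2 : Tendsto (fun s => f c + ∫ y in c..s, f' y) (𝓝[Ioo 0 1] e)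
      (𝓝 (f c + ∫ y in c..e, f' y)) :=
    (hcont.tendsto.mono_left (le_inf (nhdsWithin_le_nhds) (le_principal_iff.2 hev))).const_add _
  exact h2.congr' (by filter_upwards [hmem] with s hs using (heq s hs).symm)

theorem exists_tendsto_of_mul_deriv_integrable {f f' F : ℝ → ℂ} {e : ℝ} {L : ℂ}
    (he : e = 0 ∨ e = 1)
    (hf : ∀ s ∈ Ioo (0 : ℝ) 1, HasDerivAt f (f' s) s) (hf' : ContinuousOn f' (Ioo 0 1))
    (hG : IntegrableOn (fun s => F s * f' s) (Ioo 0 1))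
    (hF : Tendsto F (𝓝[Ioo 0 1] e) (𝓝 L)) (hL : L ≠ 0) :
    ∃ l, Tendsto f (𝓝[Ioo 0 1] e) (𝓝 l) := by
  have hL' : 0 < ‖L‖ := norm_pos_iff.2 hL
  refine exists_tendsto_of_norm_deriv_le he hf (hf'.aestronglyMeasurable measurableSet_Ioo)
    (G := fun s => ((2 / ‖L‖ : ℝ) : ℂ) * (F s * f' s)) (hG.const_mul _) ?_
  filter_upwards [hF.norm.eventually_const_lt (half_lt_self hL')] with s hs
  rw [norm_mul, norm_mul, Complex.norm_real, Real.norm_of_nonneg (by positivity), ← mul_assoc]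
  refine le_mul_of_one_le_left (norm_nonneg _) ?_
  rw [div_mul_eq_mul_div, one_le_div hL']
  linarith

end calculus

/-! ### Differentiating the branches of the master function. -/

namespace QuantumPainleve

noncomputable section

/-- The logarithmic derivative of the master function in `t`. -/
def logDerivTime (J : PainleveType) (q : Params) (t u : ℂ) : ℂ :=
  match J with
  | .VI => -q.d / (t - u)
  | .V => u
  | .IV => -u
  | .III => u⁻¹
  | .II => -u

/-- The logarithmic derivative of the master function in `u`. -/
def logDerivPos (J : PainleveType) (q : Params) (t u : ℂ) : ℂ :=
  match J with
  | .VI => (-q.a - q.b - 1) / u + (q.c + 1) / (1 - u) + q.d / (t - u)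
  | .V => (-q.b - 1) / u + (q.c + 1) / (1 - u) + t
  | .IV => (-q.b - 1) / u - t + u
  | .III => (-q.b - 1) / u - t / u ^ 2 - 1
  | .II => -(t + 2 * u ^ 2)

namespace TwistedPath

open Set MeasureTheory

variable {J : PainleveType} {U : Set ℂ} (γ : TwistedPath J U)

/-- The parameter interval of `γ`. -/
def dom : Set ℝ := pathDomain γ.openStart γ.openEnd

theorem Ioo_subset_dom : Ioo (0 : ℝ) 1 ⊆ γ.dom := fun _ hs =>
  ⟨hs.1.le, hs.2.le, fun _ => hs.1.ne', fun _ => hs.2.ne⟩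

theorem dom_mem_nhds {s : ℝ} (hs : s ∈ Ioo (0 : ℝ) 1) : γ.dom ∈ 𝓝 s :=
  mem_of_superset (Ioo_mem_nhds hs.1 hs.2) γ.Ioo_subset_dom

theorem hasDerivAt_toFun {s : ℝ} (hs : s ∈ Ioo (0 : ℝ) 1) :
    HasDerivAt γ.toFun (deriv γ.toFun s) s :=
  ((γ.contDiffOn.differentiableOn one_ne_zero).differentiableAt (γ.dom_mem_nhds hs)).hasDerivAt

theorem continuousOn_deriv : ContinuousOn (deriv γ.toFun) (Ioo 0 1) :=
  (γ.contDiffOn.mono γ.Ioo_subset_dom).continuousOn_deriv_of_isOpen isOpen_Ioo le_rfl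

theorem toFun_ne_zero (h : 0 ∈ fixedSingularities J) {s : ℝ} (hs : s ∈ γ.dom) :
    γ.toFun s ≠ 0 := by
  rw [← γ.exp_log₀ h s hs]; exact Complex.exp_ne_zero _

theorem one_sub_toFun_ne_zero (h : 1 ∈ fixedSingularities J) {s : ℝ} (hs : s ∈ γ.dom) :
    1 - γ.toFun s ≠ 0 := by
  rw [← γ.exp_log₁ h s hs]; exact Complex.exp_ne_zero _

theorem sub_toFun_ne_zero (h : J = .VI) {s : ℝ} (hs : s ∈ γ.dom) {t : ℂ} (ht : t ∈ U) :
    t - γ.toFun s ≠ 0 := by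
  rw [← γ.exp_logₜ h s hs t ht]; exact Complex.exp_ne_zero _

theorem hasDerivAt_const_sub_toFun (c : ℂ) {s : ℝ} (hs : s ∈ Ioo (0 : ℝ) 1) :
    HasDerivAt (fun y => c - γ.toFun y) (-deriv γ.toFun s) s :=
  (γ.hasDerivAt_toFun hs).const_sub c

theorem hasDerivAt_log₀ (h : 0 ∈ fixedSingularities J) {s : ℝ} (hs : s ∈ Ioo (0 : ℝ) 1) :
    HasDerivAt γ.log₀ (deriv γ.toFun s / γ.toFun s) s :=
  hasDerivAt_of_exp_eventuallyEq (γ.continuousOn_log₀.continuousAt (γ.dom_mem_nhds hs))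
    (by filter_upwards [γ.dom_mem_nhds hs] with y hy using γ.exp_log₀ h y hy) (γ.hasDerivAt_toFun hs)

theorem hasDerivAt_log₁ (h : 1 ∈ fixedSingularities J) {s : ℝ} (hs : s ∈ Ioo (0 : ℝ) 1) :
    HasDerivAt γ.log₁ (-deriv γ.toFun s / (1 - γ.toFun s)) s := by
  have h2 : ∀ᶠ y in 𝓝 s, Complex.exp (γ.log₁ y) = 1 - γ.toFun y := by
    filter_upwards [γ.dom_mem_nhds hs] with y hy using γ.exp_log₁ h y hy
  have h3 := hasDerivAt_of_exp_eventuallyEq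
    (γ.continuousOn_log₁.continuousAt (γ.dom_mem_nhds hs)) h2 (γ.hasDerivAt_const_sub_toFun 1 hs)
  exact h3

theorem continuousOn_logₜ_left {t : ℂ} (ht : t ∈ U) :
    ContinuousOn (fun s => γ.logₜ s t) γ.dom :=
  γ.continuousOn_logₜ.comp (f := fun s => (s, t)) (Continuous.continuousOn (by fun_prop))
    fun _ hs => ⟨hs, ht⟩

theorem continuousOn_logₜ_right {s : ℝ} (hs : s ∈ γ.dom) :
    ContinuousOn (fun t => γ.logₜ s t) U :=
  γ.continuousOn_logₜ.comp (f := fun t => (s, t)) (Continuous.continuousOn (by fun_prop))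
    fun _ ht => ⟨hs, ht⟩

theorem hasDerivAt_logₜ (h : J = .VI) {s : ℝ} (hs : s ∈ Ioo (0 : ℝ) 1) {t : ℂ} (ht : t ∈ U) :
    HasDerivAt (fun s => γ.logₜ s t) (-deriv γ.toFun s / (t - γ.toFun s)) s := by
  have h2 : ∀ᶠ y in 𝓝 s, Complex.exp (γ.logₜ y t) = t - γ.toFun y := by
    filter_upwards [γ.dom_mem_nhds hs] with y hy using γ.exp_logₜ h y hy t ht
  have h3 := hasDerivAt_of_exp_eventuallyEq
    ((γ.continuousOn_logₜ_left ht).continuousAt (γ.dom_mem_nhds hs)) h2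
    (γ.hasDerivAt_const_sub_toFun t hs)
  exact h3

theorem hasDerivAt_logₜ_time (h : J = .VI) (hU : IsOpen U) {s : ℝ} (hs : s ∈ γ.dom) {t : ℂ}
    (ht : t ∈ U) : HasDerivAt (fun t => γ.logₜ s t) (1 / (t - γ.toFun s)) t := by
  have h1 : HasDerivAt (fun y : ℂ => y - γ.toFun s) 1 t := (hasDerivAt_id t).sub_const _
  have h2 : ∀ᶠ y in 𝓝 t, Complex.exp (γ.logₜ s y) = y - γ.toFun s := by
    filter_upwards [hU.mem_nhds ht] with y hy using γ.exp_logₜ h s hs y hy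
  have h3 : ContinuousAt (fun t => γ.logₜ s t) t :=
    (γ.continuousOn_logₜ_right hs).continuousAt (hU.mem_nhds ht)
  have h4 := hasDerivAt_of_exp_eventuallyEq h3 h2 h1
  exact h4

theorem continuousOn_toFun : ContinuousOn γ.toFun γ.dom := γ.contDiffOn.continuousOn

theorem continuousOn_weight (q : Params) {t : ℂ} (ht : t ∈ U) :
    ContinuousOn (fun s => γ.weight q s t) γ.dom := by
  have h := γ.continuousOn_toFun
  have h0 : ContinuousOn γ.log₀ γ.dom := γ.continuousOn_log₀
  have h1 : ContinuousOn γ.log₁ γ.dom := γ.continuousOn_log₁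
  have h2 := γ.continuousOn_logₜ_left ht
  cases J <;> simp only [weight, masterFunction]
  case III =>
    have h3 : ∀ s ∈ γ.dom, γ.toFun s ≠ 0 := fun s hs => γ.toFun_ne_zero (by simp [fixedSingularities]) hs
    fun_prop (disch := assumption)
  all_goals fun_prop

theorem hasDerivAt_weight_time (q : Params) (hU : IsOpen U) {s : ℝ} (hs : s ∈ γ.dom) {t : ℂ}
    (ht : t ∈ U) : HasDerivAt (fun t => γ.weight q s t)
      (logDerivTime J q t (γ.toFun s) * γ.weight q s t) t := by
  cases J <;> simp only [weight, masterFunction, logDerivTime]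
  case VI =>
    have h := ((γ.hasDerivAt_logₜ_time rfl hU hs ht).const_mul (-q.d)).cexp.const_mul
      (Complex.exp ((-q.a - q.b - 1) * γ.log₀ s) * Complex.exp ((-q.c - 1) * γ.log₁ s))
    exact h.congr_deriv (by ring)
  case V =>
    have h := ((hasDerivAt_id t).const_mul (γ.toFun s)).cexp.const_mul
      (Complex.exp ((-q.b - 1) * γ.log₀ s) * Complex.exp ((-q.c - 1) * γ.log₁ s))
    exact h.congr_deriv (by simp; ring)
  case IV =>
    have h := (((hasDerivAt_id t).const_mul (γ.toFun s)).neg.add_const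
      (γ.toFun s ^ 2 / 2)).cexp.const_mul (Complex.exp ((-q.b - 1) * γ.log₀ s))
    exact h.congr_deriv (by simp; ring)
  case III =>
    have h := (((hasDerivAt_id t).div_const (γ.toFun s)).sub_const
      (γ.toFun s)).cexp.const_mul (Complex.exp ((-q.b - 1) * γ.log₀ s))
    exact h.congr_deriv (by simp; ring)
  case II =>
    have h := (((hasDerivAt_id t).const_mul (γ.toFun s)).add_const
      (2 / 3 * γ.toFun s ^ 3)).neg.cexp
    exact h.congr_deriv (by simp; ring)

theorem hasDerivAt_weight (q : Params) {s : ℝ} (hs : s ∈ Ioo (0 : ℝ) 1) {t : ℂ}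
    (ht : t ∈ U) : HasDerivAt (fun s => γ.weight q s t)
      (logDerivPos J q t (γ.toFun s) * γ.weight q s t * deriv γ.toFun s) s := by
  have hu := γ.hasDerivAt_toFun hs
  cases J <;> simp only [weight, masterFunction, logDerivPos]
  case VI =>
    have h := ((((γ.hasDerivAt_log₀ (by simp [fixedSingularities]) hs).const_mul
      (-q.a - q.b - 1)).cexp.fun_mul ((γ.hasDerivAt_log₁ (by simp [fixedSingularities]) hs).const_mul
      (-q.c - 1)).cexp)).fun_mul ((γ.hasDerivAt_logₜ rfl hs ht).const_mul (-q.d)).cexp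
    exact h.congr_deriv (by ring)
  case V =>
    have h := ((((γ.hasDerivAt_log₀ (by simp [fixedSingularities]) hs).const_mul
      (-q.b - 1)).cexp.fun_mul ((γ.hasDerivAt_log₁ (by simp [fixedSingularities]) hs).const_mul
      (-q.c - 1)).cexp)).fun_mul (hu.mul_const t).cexp
    exact h.congr_deriv (by ring)
  case IV =>
    have h := ((γ.hasDerivAt_log₀ (by simp [fixedSingularities]) hs).const_mul
      (-q.b - 1)).cexp.fun_mul ((hu.mul_const t).fun_neg.fun_add ((hu.fun_pow 2).div_const 2)).cexp
    exact h.congr_deriv (by simp; ring)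
  case III =>
    have h0 := γ.toFun_ne_zero (by simp [fixedSingularities]) (γ.Ioo_subset_dom hs)
    have h := ((γ.hasDerivAt_log₀ (by simp [fixedSingularities]) hs).const_mul
      (-q.b - 1)).cexp.fun_mul ((((hasDerivAt_const s t)).fun_div hu h0).fun_sub hu).cexp
    exact h.congr_deriv (by ring)
  case II =>
    have h := ((hu.mul_const t).fun_add ((hu.fun_pow 3).const_mul (2 / 3))).fun_neg.cexp
    exact h.congr_deriv (by simp; ring)

end TwistedPath

end

end QuantumPainleve

/-! ### Moments of one path: the time derivative and integration by parts. -/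

namespace QuantumPainleve

noncomputable section

/-- The polynomial `S` such that `S(u) u ^ k ρ_J(u, t)` is integrated by parts: it vanishes at the
fixed singular points. -/
def cutoff (J : PainleveType) (u : ℂ) : ℂ :=
  match J with
  | .VI | .V => u * (1 - u)
  | .IV | .III => u
  | .II => 1

/-- The derivative of `cutoff`. -/
def cutoffDeriv (J : PainleveType) (u : ℂ) : ℂ :=
  match J with
  | .VI | .V => 1 - 2 * u
  | .IV | .III => 1
  | .II => 0

theorem hasDerivAt_cutoff (J : PainleveType) (u : ℂ) :
    HasDerivAt (cutoff J) (cutoffDeriv J u) u := by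
  have h1 : HasDerivAt (fun u : ℂ => u * (1 - u)) (1 - 2 * u) u :=
    ((hasDerivAt_id u).fun_mul ((hasDerivAt_id u).const_sub 1)).congr_deriv (by simp; ring)
  cases J
  · exact hasDerivAt_const u 1
  · exact hasDerivAt_id u
  · exact hasDerivAt_id u
  · exact h1
  · exact h1

namespace TwistedPath

open Set MeasureTheory

variable {J : PainleveType} {U : Set ℂ} (γ : TwistedPath J U)

theorem continuousOn_integrand (q : Params) (k : ℕ) {t : ℂ} (ht : t ∈ U) :
    ContinuousOn (fun s => γ.integrand q k s t) (Ioo 0 1) :=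
  (((γ.continuousOn_toFun.mono γ.Ioo_subset_dom).pow k).mul
    ((γ.continuousOn_weight q ht).mono γ.Ioo_subset_dom)).mul γ.continuousOn_deriv

/-- The derivative in `t` of the integrand. -/
def integrandDeriv (q : Params) (k : ℕ) (s : ℝ) (t : ℂ) : ℂ :=
  logDerivTime J q t (γ.toFun s) * γ.integrand q k s t

theorem continuousOn_integrandDeriv (q : Params) (k : ℕ) {t : ℂ} (ht : t ∈ U) :
    ContinuousOn (fun s => γ.integrandDeriv q k s t) (Ioo 0 1) := by
  refine ContinuousOn.mul ?_ (γ.continuousOn_integrand q k ht)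
  have h := γ.continuousOn_toFun.mono γ.Ioo_subset_dom
  cases J <;> simp only [logDerivTime]
  case VI =>
    exact continuousOn_const.div (continuousOn_const.sub h)
      fun s hs => γ.sub_toFun_ne_zero rfl (γ.Ioo_subset_dom hs) ht
  case III =>
    exact h.inv₀ fun s hs => γ.toFun_ne_zero (by simp [fixedSingularities]) (γ.Ioo_subset_dom hs)
  all_goals fun_prop

theorem hasDerivAt_integrand (q : Params) (hU : IsOpen U) (k : ℕ) {s : ℝ}
    (hs : s ∈ Ioo (0 : ℝ) 1) {t : ℂ} (ht : t ∈ U) :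
    HasDerivAt (fun t => γ.integrand q k s t) (γ.integrandDeriv q k s t) t := by
  have h := ((γ.hasDerivAt_weight_time q hU (γ.Ioo_subset_dom hs) ht).const_mul
    (γ.toFun s ^ k)).mul_const (deriv γ.toFun s)
  refine h.congr_deriv ?_
  rw [integrandDeriv, integrand]
  ring

/-- Differentiation of a moment under the integral sign. -/
theorem hasDerivAt_moment (q : Params) (hU : IsOpen U) (k : ℕ) {t : ℂ} (ht : t ∈ U)
    (hdom : ∃ V ∈ 𝓝 t, ∃ g : ℝ → ℝ, IntegrableOn g (Ioo (0 : ℝ) 1) ∧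
      ∀ t ∈ V, ∀ s ∈ Ioo (0 : ℝ) 1, ‖γ.integrand q k s t‖ ≤ g s) :
    IntegrableOn (fun s => γ.integrand q k s t) (Ioo 0 1) ∧
    IntegrableOn (fun s => γ.integrandDeriv q k s t) (Ioo 0 1) ∧
    HasDerivAt (γ.moment q k) (∫ s in Ioo (0 : ℝ) 1, γ.integrandDeriv q k s t) t := by
  obtain ⟨V, hV, g, hg, hle⟩ := hdom
  obtain ⟨ε, hε, hball⟩ := Metric.mem_nhds_iff.1 (inter_mem hV (hU.mem_nhds ht))
  have hr : 0 < ε / 2 := half_pos hε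
  have hsub : ∀ z ∈ Metric.ball t (ε / 2), Metric.closedBall z (ε / 2) ⊆ V ∩ U := by
    intro z hz w hw
    refine hball ?_
    rw [Metric.mem_ball] at hz ⊢
    rw [Metric.mem_closedBall] at hw
    linarith [dist_triangle w z t]
  have hint : IntegrableOn (fun s => γ.integrand q k s t) (Ioo 0 1) :=
    Integrable.mono' hg ((γ.continuousOn_integrand q k ht).aestronglyMeasurable measurableSet_Ioo)
      ((ae_restrict_mem measurableSet_Ioo).mono fun s hs => hle t (mem_of_mem_nhds hV) s hs)
  refine ⟨hint, hasDerivAt_integral_of_dominated_loc_of_deriv_le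
    (F := fun t s => γ.integrand q k s t) (F' := fun t s => γ.integrandDeriv q k s t)
    (bound := fun s => g s / (ε / 2)) (Metric.ball_mem_nhds t hr) ?_ hint ?_ ?_
    (hg.div_const _) ?_⟩
  · filter_upwards [hU.mem_nhds ht] with z hz
    exact (γ.continuousOn_integrand q k hz).aestronglyMeasurable measurableSet_Ioo
  · exact (γ.continuousOn_integrandDeriv q k ht).aestronglyMeasurable measurableSet_Ioo
  · refine (ae_restrict_mem measurableSet_Ioo).mono fun s hs z hz => ?_
    have hzU : z ∈ U := (hsub z hz (Metric.mem_closedBall_self hr.le)).2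
    rw [← (γ.hasDerivAt_integrand q hU k hs hzU).deriv]
    -- Cauchy's estimate on a circle of radius `ε / 2` inside `V ∩ U` bounds the time derivative by
    -- `g s / (ε / 2)`.
    refine Complex.norm_deriv_le_of_forall_mem_sphere_norm_le hr ?_ fun w hw =>
      hle w (hsub z hz (Metric.sphere_subset_closedBall hw)).1 s hs
    refine DifferentiableOn.diffContOnCl_ball (U := U) (fun w hw => ?_)
      fun w hw => (hsub z hz hw).2
    exact (γ.hasDerivAt_integrand q hU k hs hw).differentiableAt.differentiableWithinAt
  · refine (ae_restrict_mem measurableSet_Ioo).mono fun s hs z hz => ?_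
    exact γ.hasDerivAt_integrand q hU k hs (hsub z hz (Metric.mem_closedBall_self hr.le)).2

/-- The function `S(u) u ^ k ρ_J(u, t)` along the path. -/
def primitive (q : Params) (k : ℕ) (t : ℂ) (s : ℝ) : ℂ :=
  cutoff J (γ.toFun s) * γ.toFun s ^ k * γ.weight q s t

/-- The derivative of `primitive` along the path. -/
def primitiveDeriv (q : Params) (k : ℕ) (t : ℂ) (s : ℝ) : ℂ :=
  (cutoffDeriv J (γ.toFun s) * γ.toFun s ^ k
    + cutoff J (γ.toFun s) * (k * γ.toFun s ^ (k - 1))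
    + cutoff J (γ.toFun s) * γ.toFun s ^ k * logDerivPos J q t (γ.toFun s))
    * γ.weight q s t * deriv γ.toFun s

theorem continuousOn_primitive (q : Params) (k : ℕ) {t : ℂ} (ht : t ∈ U) :
    ContinuousOn (γ.primitive q k t) γ.dom := by
  have hc : Continuous (cutoff J) :=
    continuous_iff_continuousAt.2 fun u => (hasDerivAt_cutoff J u).continuousAt
  exact ((hc.comp_continuousOn γ.continuousOn_toFun).mul (γ.continuousOn_toFun.pow k)).mul
    (γ.continuousOn_weight q ht)

theorem hasDerivAt_primitive (q : Params) (k : ℕ) {t : ℂ} (ht : t ∈ U) {s : ℝ}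
    (hs : s ∈ Ioo (0 : ℝ) 1) :
    HasDerivAt (γ.primitive q k t) (γ.primitiveDeriv q k t s) s := by
  have hu := γ.hasDerivAt_toFun hs
  have h := (((hasDerivAt_cutoff J (γ.toFun s)).comp s hu).fun_mul (hu.fun_pow k)).fun_mul
    (γ.hasDerivAt_weight q hs ht)
  refine h.congr_deriv ?_
  simp only [primitiveDeriv, Function.comp_apply]
  ring

section ends

variable {q : Params} {k : ℕ} {t : ℂ}

/-- The cutoff is divisible by `u`, so the primitive times `du / u` is a combination of integrands
of moments. A nonzero limit of the primitive at an end would thus make `du / u` integrable there. -/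
theorem integrableOn_primitive_mul_log₀ (h : 0 ∈ fixedSingularities J)
    (h₁ : IntegrableOn (fun s => γ.integrand q k s t) (Ioo 0 1))
    (h₂ : IntegrableOn (fun s => γ.integrand q (k + 1) s t) (Ioo 0 1)) :
    IntegrableOn (fun s => γ.primitive q k t s * (deriv γ.toFun s / γ.toFun s)) (Ioo 0 1) := by
  have h0 : ∀ s ∈ Ioo (0 : ℝ) 1, γ.toFun s ≠ 0 := fun s hs =>
    γ.toFun_ne_zero h (γ.Ioo_subset_dom hs)
  cases J
  case II => simp [fixedSingularities] at h
  case III | IV =>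
    refine h₁.congr_fun (fun s hs => ?_) measurableSet_Ioo
    have := h0 s hs
    simp only [primitive, integrand, cutoff]
    field_simp
  case V | VI =>
    refine (h₁.sub h₂).congr_fun (fun s hs => ?_) measurableSet_Ioo
    have := h0 s hs
    simp only [primitive, integrand, cutoff, Pi.sub_apply]
    field_simp
    ring

theorem integrableOn_primitive_mul_log₁ (h : 1 ∈ fixedSingularities J)
    (h₂ : IntegrableOn (fun s => γ.integrand q (k + 1) s t) (Ioo 0 1)) :
    IntegrableOn (fun s => γ.primitive q k t s * (-deriv γ.toFun s / (1 - γ.toFun s)))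
      (Ioo 0 1) := by
  have h0 : ∀ s ∈ Ioo (0 : ℝ) 1, 1 - γ.toFun s ≠ 0 := fun s hs =>
    γ.one_sub_toFun_ne_zero h (γ.Ioo_subset_dom hs)
  cases J
  case II | III | IV => simp [fixedSingularities] at h
  case V | VI =>
    refine h₂.neg.congr_fun (fun s hs => ?_) measurableSet_Ioo
    have := h0 s hs
    simp only [primitive, integrand, cutoff, Pi.neg_apply]
    field_simp
    ring

/-- At an open end every limit of the primitive is zero, as the moments converge. -/
theorem eq_zero_of_tendsto_primitive {e : ℝ} {L : ℂ} (he : e = 0 ∨ e = 1)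
    (h₁ : IntegrableOn (fun s => γ.integrand q k s t) (Ioo 0 1))
    (h₂ : IntegrableOn (fun s => γ.integrand q (k + 1) s t) (Ioo 0 1))
    (hsing : RunsIntoSingularity J γ.toFun (𝓝[Ioo 0 1] e))
    (hL : Tendsto (γ.primitive q k t) (𝓝[Ioo 0 1] e) (𝓝 L)) : L = 0 := by
  by_contra hL0
  have hcl : e ∈ closure (Ioo (0 : ℝ) 1) := by
    rw [closure_Ioo zero_ne_one]; rcases he with rfl | rfl <;> simp
  have : (𝓝[Ioo (0 : ℝ) 1] e).NeBot := mem_closure_iff_nhdsWithin_neBot.1 hcl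
  have hcu : ContinuousOn γ.toFun (Ioo 0 1) := γ.continuousOn_toFun.mono γ.Ioo_subset_dom
  -- If `L ≠ 0`, then `du / u` is integrable near the end, so the logarithm of `u` converges and `u`
  -- has a finite nonzero limit. This excludes `∞` and `0`; `lim₁` excludes `1` in the same way.
  have lim₀ : 0 ∈ fixedSingularities J →
      ∃ l, Tendsto γ.toFun (𝓝[Ioo 0 1] e) (𝓝 (Complex.exp l)) := by
    intro h
    obtain ⟨l, hl⟩ := exists_tendsto_of_mul_deriv_integrable he
      (fun s hs => γ.hasDerivAt_log₀ h hs)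
      (γ.continuousOn_deriv.div hcu fun s hs => γ.toFun_ne_zero h (γ.Ioo_subset_dom hs))
      (γ.integrableOn_primitive_mul_log₀ h h₁ h₂) hL hL0
    refine ⟨l, hl.cexp.congr' ?_⟩
    filter_upwards [self_mem_nhdsWithin] with s hs using γ.exp_log₀ h s (γ.Ioo_subset_dom hs)
  have lim₁ : 1 ∈ fixedSingularities J →
      ∃ l, Tendsto (fun s => 1 - γ.toFun s) (𝓝[Ioo 0 1] e) (𝓝 (Complex.exp l)) := by
    intro h
    obtain ⟨l, hl⟩ := exists_tendsto_of_mul_deriv_integrable he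
      (fun s hs => γ.hasDerivAt_log₁ h hs)
      (γ.continuousOn_deriv.neg.div (continuousOn_const.sub hcu)
        fun s hs => γ.one_sub_toFun_ne_zero h (γ.Ioo_subset_dom hs))
      (γ.integrableOn_primitive_mul_log₁ h h₂) hL hL0
    refine ⟨l, hl.cexp.congr' ?_⟩
    filter_upwards [self_mem_nhdsWithin] with s hs using γ.exp_log₁ h s (γ.Ioo_subset_dom hs)
  have lim : ∃ l, Tendsto γ.toFun (𝓝[Ioo 0 1] e) (𝓝 l) := by
    by_cases h : 0 ∈ fixedSingularities J
    · obtain ⟨l, hl⟩ := lim₀ h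
      exact ⟨_, hl⟩
    · have hJ : J = .II := by cases J <;> simp [fixedSingularities] at h ⊢
      subst hJ
      refine exists_tendsto_of_mul_deriv_integrable he (fun s hs => γ.hasDerivAt_toFun hs)
        γ.continuousOn_deriv (h₁.congr_fun (fun s _ => ?_) measurableSet_Ioo) hL hL0
      simp only [primitive, integrand, cutoff, one_mul]
  rcases hsing with h | ⟨p, hp, h⟩
  · obtain ⟨l, hl⟩ := lim
    exact hl.not_tendsto (Metric.disjoint_nhds_cobounded l) h
  · have hp' : (0 ∈ fixedSingularities J ∧ p = 0) ∨ (1 ∈ fixedSingularities J ∧ p = 1) := by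
      cases J <;> simp [fixedSingularities] at hp ⊢ <;> exact hp
    rcases hp' with ⟨h0, rfl⟩ | ⟨h1, rfl⟩
    · obtain ⟨l, hl⟩ := lim₀ h0
      exact Complex.exp_ne_zero l (tendsto_nhds_unique hl h)
    · obtain ⟨l, hl⟩ := lim₁ h1
      exact Complex.exp_ne_zero l (tendsto_nhds_unique hl (by simpa using h.const_sub 1))

/-- Integration by parts along a path: open ends do not contribute. -/
theorem integral_primitiveDeriv (ht : t ∈ U)
    (h₁ : IntegrableOn (fun s => γ.integrand q k s t) (Ioo 0 1))
    (h₂ : IntegrableOn (fun s => γ.integrand q (k + 1) s t) (Ioo 0 1))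
    (h₃ : IntegrableOn (γ.primitiveDeriv q k t) (Ioo 0 1)) :
    ∫ s in Ioo (0 : ℝ) 1, γ.primitiveDeriv q k t s =
      (if γ.openEnd = false then γ.primitive q k t 1 else 0)
        - (if γ.openStart = false then γ.primitive q k t 0 else 0) := by
  have hopen : ∀ e : ℝ, (e = 0 ∨ e = 1) → RunsIntoSingularity J γ.toFun (𝓝[Ioo 0 1] e) →
      Tendsto (γ.primitive q k t) (𝓝[Ioo 0 1] e) (𝓝 0) := by
    intro e he hsing
    -- The limit exists because the derivative of the primitive is integrable; it is then zero by
    -- the convergence of the moments.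
    obtain ⟨L, hL⟩ := exists_tendsto_of_norm_deriv_le he
      (fun s hs => γ.hasDerivAt_primitive q k ht hs) h₃.aestronglyMeasurable h₃
      (Eventually.of_forall fun s => le_rfl)
    rwa [γ.eq_zero_of_tendsto_primitive he h₁ h₂ hsing hL] at hL
  have hclosed : ∀ e ∈ γ.dom,
      Tendsto (γ.primitive q k t) (𝓝[Ioo 0 1] e) (𝓝 (γ.primitive q k t e)) := fun e he =>
    ((γ.continuousOn_primitive q k ht) e he).mono γ.Ioo_subset_dom
  have hend := nhdsWithin_Ioo_eq_nhdsLT (zero_lt_one' ℝ)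
  have hstart := nhdsWithin_Ioo_eq_nhdsGT (zero_lt_one' ℝ)
  rw [← integral_Ioc_eq_integral_Ioo, ← intervalIntegral.integral_of_le zero_le_one]
  refine intervalIntegral.integral_eq_sub_of_hasDerivAt_of_tendsto zero_lt_one
    (fun s hs => γ.hasDerivAt_primitive q k ht hs)
    ((intervalIntegrable_iff_integrableOn_Ioo_of_le zero_le_one).2 h₃) ?_ ?_
  · rw [← hstart]
    split_ifs with h
    · exact hclosed 0 ⟨le_rfl, zero_le_one, by simp [h], by simp⟩
    · refine hopen 0 (Or.inl rfl) ?_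
      rw [hstart]
      exact γ.start_singular (by simpa using h)
  · rw [← hend]
    split_ifs with h
    · exact hclosed 1 ⟨zero_le_one, le_rfl, by simp, by simp [h]⟩
    · refine hopen 1 (Or.inr rfl) ?_
      rw [hend]
      exact γ.end_singular (by simpa using h)

end ends

end TwistedPath

end

end QuantumPainleve

/-! ### The moment relation on cycles and the comparison with the Hamiltonian. -/

namespace QuantumPainleve

noncomputable section

/-- The coefficients of the first order relation
`τ'_{k+1} - x τ'_k = k q₀ τ_{k-1} + (k q₁ + r₀) τ_k + (k q₂ + r₁) τ_{k+1}` between the moments and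
their derivatives; `factor` is the coefficient of the exact form that is added. -/
structure MomentRelation where
  q₀ : ℂ
  q₁ : ℂ
  q₂ : ℂ
  r₀ : ℂ
  r₁ : ℂ
  factor : ℂ

/-- The relation for each type. -/
def momentRelation (J : PainleveType) (q : Params) (t x : ℂ) : MomentRelation :=
  match J with
  | .VI =>
      { q₀ := 0
        q₁ := -((t - x) / (t * (t - 1)))
        q₂ := (t - x) / (t * (t - 1))
        r₀ := q.d + (t - x) / (t * (t - 1)) * (q.a + q.b + q.d * (1 - t))
        r₁ := -((t - x) / (t * (t - 1)) * (q.a + q.b + q.c + q.d))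
        factor := (t - x) / (t * (t - 1)) }
  | .V =>
      { q₀ := 0
        q₁ := 1 / t
        q₂ := -(1 / t)
        r₀ := -q.b / t
        r₁ := (q.b + q.c + t - x * t) / t
        factor := -(1 / t) }
  | .IV => { q₀ := 0, q₁ := 1, q₂ := 0, r₀ := -q.b, r₁ := x - t, factor := -1 }
  | .III =>
      { q₀ := 0
        q₁ := -x / t
        q₂ := 0
        r₀ := (t + x * q.b) / t
        r₁ := x / t
        factor := x / t }
  | .II => { q₀ := -(1 / 2), q₁ := 0, q₂ := 0, r₀ := t / 2, r₁ := x, factor := 1 / 2 }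

/-- The factor is chosen so that the exact form removes from `(u - x) ∂ₜ log ρ` what is not
polynomial of degree at most one in `u`: the pole at `u = t` (VI), the pole at `0` (III), the term
`u ^ 2` (II, IV, V). Then `Q = -factor * S`, and `R` is the remaining affine part. -/
theorem momentRelation_spec (J : PainleveType) (q : Params) {t : ℂ} (x u : ℂ) (k : ℕ)
    (ht : IsRegularTime J t) (h0 : 0 ∈ fixedSingularities J → u ≠ 0)
    (h1 : 1 ∈ fixedSingularities J → 1 - u ≠ 0) (h2 : J = .VI → t - u ≠ 0) :
    logDerivTime J q t u * u ^ (k + 1) - x * (logDerivTime J q t u * u ^ k)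
      - (k * (momentRelation J q t x).q₀ * u ^ (k - 1)
        + (k * (momentRelation J q t x).q₁ + (momentRelation J q t x).r₀) * u ^ k
        + (k * (momentRelation J q t x).q₂ + (momentRelation J q t x).r₁) * u ^ (k + 1)) =
    (momentRelation J q t x).factor * (cutoffDeriv J u * u ^ k + cutoff J u * (k * u ^ (k - 1))
      + cutoff J u * u ^ k * logDerivPos J q t u) := by
  -- For `k = 0` the truncated exponent `k - 1` is harmless, as its coefficient vanishes.
  have hk : u * (k * u ^ (k - 1)) = k * u ^ k := by
    rcases k with _ | k
    · simp
    · simp only [Nat.add_sub_cancel]; ring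
  cases J <;> simp only [fixedSingularities, IsRegularTime, Set.mem_insert_iff,
    Set.mem_singleton_iff, true_or, or_true, forall_const, Set.mem_empty_iff_false] at ht h0 h1 h2
  case II =>
    simp only [logDerivTime, momentRelation, cutoff, cutoffDeriv, logDerivPos]
    ring
  case III =>
    simp only [logDerivTime, momentRelation, cutoff, cutoffDeriv, logDerivPos, hk]
    field_simp
    ring
  case IV =>
    simp only [logDerivTime, momentRelation, cutoff, cutoffDeriv, logDerivPos, hk]
    field_simp
    ring
  case V =>
    simp only [logDerivTime, momentRelation, cutoff, cutoffDeriv, logDerivPos,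
      mul_right_comm u (1 - u), hk]
    field_simp
    ring
  case VI =>
    obtain ⟨ht0, ht1⟩ := ht
    have ht1 : t - 1 ≠ 0 := sub_ne_zero.2 ht1
    simp only [logDerivTime, momentRelation, cutoff, cutoffDeriv, logDerivPos,
      mul_right_comm u (1 - u), hk]
    field_simp
    ring

namespace TwistedPath

open Set MeasureTheory

variable {J : PainleveType} {U : Set ℂ} (γ : TwistedPath J U)

/-- The first order relation for the moments of a path, up to boundary terms. -/
theorem moment_relation {q : Params} {t : ℂ} (x : ℂ) {k : ℕ} (ht : t ∈ U)
    (hreg : IsRegularTime J t)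
    (hint : ∀ n ≤ k + 1, IntegrableOn (fun s => γ.integrand q n s t) (Ioo 0 1))
    (hint' : ∀ n ≤ k + 1, IntegrableOn (fun s => γ.integrandDeriv q n s t) (Ioo 0 1)) :
    (∫ s in Ioo (0 : ℝ) 1, γ.integrandDeriv q (k + 1) s t)
      - x * (∫ s in Ioo (0 : ℝ) 1, γ.integrandDeriv q k s t)
      - (k * (momentRelation J q t x).q₀ * γ.moment q (k - 1) t
        + (k * (momentRelation J q t x).q₁ + (momentRelation J q t x).r₀) * γ.moment q k t
        + (k * (momentRelation J q t x).q₂ + (momentRelation J q t x).r₁)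
          * γ.moment q (k + 1) t) =
    (momentRelation J q t x).factor *
      ((if γ.openEnd = false then γ.primitive q k t 1 else 0)
        - (if γ.openStart = false then γ.primitive q k t 0 else 0)) := by
  set ρ := momentRelation J q t x
  let E : ℝ → ℂ := fun s => γ.integrandDeriv q (k + 1) s t - x * γ.integrandDeriv q k s t
    - (k * ρ.q₀ * γ.integrand q (k - 1) s t + (k * ρ.q₁ + ρ.r₀) * γ.integrand q k s t
      + (k * ρ.q₂ + ρ.r₁) * γ.integrand q (k + 1) s t)
  have i1 := hint' (k + 1) le_rfl
  have i2 := (hint' k (by omega)).const_mul x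
  have i3 := (hint (k - 1) (by omega)).const_mul (k * ρ.q₀)
  have i4 := (hint k (by omega)).const_mul (k * ρ.q₁ + ρ.r₀)
  have i5 := (hint (k + 1) le_rfl).const_mul (k * ρ.q₂ + ρ.r₁)
  have i12 : IntegrableOn (fun s => γ.integrandDeriv q (k + 1) s t
    - x * γ.integrandDeriv q k s t) (Ioo 0 1) := i1.sub i2
  have i34 : IntegrableOn (fun s => k * ρ.q₀ * γ.integrand q (k - 1) s t
    + (k * ρ.q₁ + ρ.r₀) * γ.integrand q k s t) (Ioo 0 1) := i3.add i4
  have i345 : IntegrableOn (fun s => k * ρ.q₀ * γ.integrand q (k - 1) s t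
    + (k * ρ.q₁ + ρ.r₀) * γ.integrand q k s t
    + (k * ρ.q₂ + ρ.r₁) * γ.integrand q (k + 1) s t) (Ioo 0 1) := i34.add i5
  have hE : IntegrableOn E (Ioo 0 1) := i12.sub i345
  have hEq : ∀ s ∈ Ioo (0 : ℝ) 1, E s = ρ.factor * γ.primitiveDeriv q k t s := by
    intro s hs
    have h := momentRelation_spec J q x (γ.toFun s) k hreg
      (fun h => γ.toFun_ne_zero h (γ.Ioo_subset_dom hs))
      (fun h => γ.one_sub_toFun_ne_zero h (γ.Ioo_subset_dom hs))
      (fun h => γ.sub_toFun_ne_zero h (γ.Ioo_subset_dom hs) ht)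
    simp only [E, integrandDeriv, integrand, primitiveDeriv]
    linear_combination γ.weight q s t * deriv γ.toFun s * h
  have hEint : ∫ s in Ioo (0 : ℝ) 1, E s =
      (∫ s in Ioo (0 : ℝ) 1, γ.integrandDeriv q (k + 1) s t)
      - x * (∫ s in Ioo (0 : ℝ) 1, γ.integrandDeriv q k s t)
      - (k * ρ.q₀ * γ.moment q (k - 1) t + (k * ρ.q₁ + ρ.r₀) * γ.moment q k t
        + (k * ρ.q₂ + ρ.r₁) * γ.moment q (k + 1) t) := by
    simp only [E, moment]
    rw [integral_sub i12 i345, integral_sub i1 i2, integral_add i34 i5, integral_add i3 i4]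
    simp only [integral_const_mul]
  rw [← hEint, setIntegral_congr_fun measurableSet_Ioo hEq, integral_const_mul]
  -- The primitive's derivative is known to be integrable only as `factor⁻¹ * E`. The factor does
  -- vanish at `x = t` in type VI and at `x = 0` in type III, where no boundary term is needed.
  by_cases hf : ρ.factor = 0
  · simp [hf]
  · rw [γ.integral_primitiveDeriv ht (hint k (by omega)) (hint (k + 1) le_rfl)]
    have hE' : IntegrableOn (fun s => ρ.factor⁻¹ * E s) (Ioo 0 1) := hE.const_mul _
    refine hE'.congr_fun (fun s hs => ?_) measurableSet_Ioo
    simp only [hEq s hs, inv_mul_cancel_left₀ hf]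

end TwistedPath

namespace TwistedChain

open Set MeasureTheory

variable {J : PainleveType} {U : Set ℂ} (Γ : TwistedChain J U)

/-- The sum of a function over the twisted boundary of a cycle vanishes. -/
theorem IsCycle.sum_boundary_eq_zero {Γ : TwistedChain J U} {q : Params} (h : Γ.IsCycle q) {t : ℂ}
    (ht : t ∈ U) (f : ℂ → ℂ) :
    ∑ j, Γ.coeff j *
      ((if (Γ.path j).openEnd = false then f ((Γ.path j).toFun 1) * (Γ.path j).weight q 1 t else 0)
      - (if (Γ.path j).openStart = false
          then f ((Γ.path j).toFun 0) * (Γ.path j).weight q 0 t else 0)) = 0 := by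
  classical
  let S : Finset ℂ := Finset.univ.image (fun j => (Γ.path j).toFun 1) ∪
    Finset.univ.image (fun j => (Γ.path j).toFun 0)
  have key : ∀ (A : Prop) [Decidable A] (e : ℂ) (w : ℂ), e ∈ S →
      ∑ p ∈ S, f p * (if A ∧ e = p then w else 0) = if A then f e * w else 0 := by
    intro A _ e w he
    by_cases hA : A <;> simp [hA, he]
  -- At each point `p` all boundary terms carry the same value `f p`, so the sum groups into
  -- multiples of the boundary coefficients.
  calc _ = ∑ p ∈ S, f p * ∑ j, Γ.coeff j * (Γ.path j).boundaryAt q t p := by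
        simp_rw [Finset.mul_sum]
        rw [Finset.sum_comm]
        refine Finset.sum_congr rfl fun j _ => ?_
        rw [← key _ _ ((Γ.path j).weight q 1 t) (by simp [S]),
          ← key _ _ ((Γ.path j).weight q 0 t) (by simp [S]), ← Finset.sum_sub_distrib,
          Finset.mul_sum]
        refine Finset.sum_congr rfl fun p _ => ?_
        rw [TwistedPath.boundaryAt]
        ring
    _ = 0 := Finset.sum_eq_zero fun p _ => by rw [h t ht p, mul_zero]

/-- The derivative of the moment `tau`. -/
def tauDeriv (q : Params) (k : ℕ) (t : ℂ) : ℂ :=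
  ∑ j, Γ.coeff j * ∫ s in Ioo (0 : ℝ) 1, (Γ.path j).integrandDeriv q k s t

theorem hasDerivAt_tau {q : Params} {N : ℕ} (hU : IsOpen U) (hconv : Γ.MomentsConverge q N)
    {t : ℂ} (ht : t ∈ U) {k : ℕ} (hk : k < N) :
    HasDerivAt (Γ.tau q k) (Γ.tauDeriv q k t) t :=
  HasDerivAt.fun_sum fun j _ =>
    ((Γ.path j).hasDerivAt_moment q hU k ht (hconv j k hk t ht)).2.2.const_mul _

theorem tau_relation {q : Params} {N : ℕ} (hU : IsOpen U) (hconv : Γ.MomentsConverge q N)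
    (hcycle : Γ.IsCycle q) {t : ℂ} (ht : t ∈ U) (hreg : IsRegularTime J t) (x : ℂ) {k : ℕ}
    (hk : k + 1 < N) :
    Γ.tauDeriv q (k + 1) t - x * Γ.tauDeriv q k t =
      k * (momentRelation J q t x).q₀ * Γ.tau q (k - 1) t
        + (k * (momentRelation J q t x).q₁ + (momentRelation J q t x).r₀) * Γ.tau q k t
        + (k * (momentRelation J q t x).q₂ + (momentRelation J q t x).r₁)
          * Γ.tau q (k + 1) t := by
  have hb := hcycle.sum_boundary_eq_zero ht fun u => cutoff J u * u ^ k
  have hrel := fun j => (Γ.path j).moment_relation x ht hreg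
    (fun n hn => ((Γ.path j).hasDerivAt_moment q hU n ht (hconv j n (by omega) t ht)).1)
    (fun n hn => ((Γ.path j).hasDerivAt_moment q hU n ht (hconv j n (by omega) t ht)).2.1)
    (q := q) (k := k)
  rw [← sub_eq_zero, ← mul_zero (momentRelation J q t x).factor, ← hb]
  simp only [tauDeriv, tau, Finset.mul_sum, ← Finset.sum_add_distrib, ← Finset.sum_sub_distrib]
  refine Finset.sum_congr rfl fun j _ => ?_
  have h := hrel j
  simp only [TwistedPath.primitive] at h
  linear_combination Γ.coeff j * h

end TwistedChain

/-- The coefficients of `f''` and `f'` agree identically. In type VI the terms of order zero differ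
by a multiple of `m (a + b + c + d + 1 - m) - a (b + c + d + 1) = (m - a) (b + c + d + 1 - m)`,
which explains the two alternatives for the parameters. -/
theorem hamiltonian_eq {J : PainleveType} {q : Params} {m : ℕ} {t : ℂ} (ht : IsRegularTime J t)
    (hpar : q.a = (m : ℂ) ∨ (J = .VI ∧ q.b + q.c + q.d = (m : ℂ) - 1)) (f : ℂ → ℂ) (x : ℂ) :
    hamiltonian J 1 q t f x =
      -((momentRelation J q t x).q₀ + (momentRelation J q t x).q₁ * x
          + (momentRelation J q t x).q₂ * x ^ 2) * deriv (deriv f) x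
        - ((momentRelation J q t x).r₀ + (momentRelation J q t x).r₁ * x) * deriv f x
        + (m * (momentRelation J q t x).r₁ + m * (m - 1) * (momentRelation J q t x).q₂) * f x := by
  have hm : momentum 1 f = deriv f := by ext y; simp [momentum]
  have hm2 : momentum 1 (deriv f) = deriv (deriv f) := by ext y; simp [momentum]
  cases J <;> simp only [hamiltonian, momentRelation, hm, hm2, IsRegularTime, reduceCtorEq,
    false_and, or_false, true_and] at ht hpar ⊢
  case II =>
    rw [hpar]; ring
  case III =>
    rw [hpar]; field_simp; ring
  case IV =>
    rw [hpar]; ring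
  case V =>
    rw [hpar]; field_simp; ring
  case VI =>
    obtain ⟨ht0, ht1⟩ := ht
    have ht1 : t - 1 ≠ 0 := sub_ne_zero.2 ht1
    rcases hpar with h | h
    · rw [h]; field_simp; ring
    · have hb : q.b = m - 1 - q.c - q.d := by linear_combination h
      rw [hb]; field_simp; ring

end

end QuantumPainleve

theorem mainTheorem4 (J : QuantumPainleve.PainleveType) (q : QuantumPainleve.Params) (m : ℕ)
    (U : Set ℂ) (hU : IsOpen U) (hreg : ∀ t ∈ U, QuantumPainleve.IsRegularTime J t)
    (hpar : q.a = (m : ℂ) ∨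
      (J = QuantumPainleve.PainleveType.VI ∧ q.b + q.c + q.d = (m : ℂ) - 1))
    (Γ : QuantumPainleve.TwistedChain J U) (hcycle : Γ.IsCycle q)
    (hconv : Γ.MomentsConverge q (2 * m)) :
    QuantumPainleve.SolvesSchrodinger J 1 q U (fun x t => Γ.detFormula q m x t) := by
  refine ⟨fun t _ x => (PainleveHankel.hasDerivAt_orthogonalDet (m := m)
    (fun k => Γ.tau q k t) x).differentiableAt, fun t ht x => ?_⟩
  have h := PainleveHankel.hasDerivAt_orthogonalDet_time (τ := fun s k => Γ.tau q k s)
    (fun k hk => Γ.hasDerivAt_tau hU hconv ht hk)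
    (fun k hk => Γ.tau_relation hU hconv hcycle ht (hreg t ht) x hk)
  refine ⟨h.differentiableAt, ?_⟩
  rw [one_mul, QuantumPainleve.hamiltonian_eq (hreg t ht) hpar]
  exact h.deriv
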